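/- Let $n,m\ge 0$ be integers, let $f:\mathbb{R}^n\to(-\infty,+\infty]$ and $g:\mathbb{R}^m\to(-\infty,+\infty]$ be proper convex functions, and let $x^\star\in\mathbb{R}^n$, $v^\star\in\mathbb{R}^m$. Let $\Phi\in\mathbb{R}^{m\times n}$ be a random matrix with i.i.d. standard normal entries and put $y=\Phi x^\star+\sqrt m\,v^\star$. Consider the two programs $$\text{(I)}\quad \min_{x,v} f(x)\ \text{ s.t. } y=\Phi x+\sqrt m\,v,\ g(v)\le g(v^\star),\qquad \text{(II)}\quad \min_{x,v} g(v)\ \text{ s.t. } y=\Phi x+\sqrt m\,v,\ f(x)\le f(x^\star).$$ A program *succeeds* if $(x^\star,v^\star)$ is its unique optimal solution, and *fails* otherwise. For a function $h$ on $\mathbb{R}^d$ and $z\in\mathbb{R}^d$ let $$\mathcal{T}_h(z)=\{u\in\mathbb{R}^d:\ h(z+tu)\le h(z)\ \text{for some } t>0\},$$ and for a subset $S$ of the unit sphere $\mathbb{S}^{d-1}\subset\mathbb{R}^d$ let $\omega(S)=\mathbb{E}\sup_{u\in S}\langle \gamma,u\rangle$ with $\gamma\sim\mathcal{N}(0,I_d)$,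 where $\omega(\emptyset)=0$. Assume that $\mathcal{T}_f(x^\star)$ and $\mathcal{T}_g(v^\star)$ are nonempty and closed, and set $$\mathscr{C}_p=\omega^2\big(\mathcal{T}_f(x^\star)\cap\mathbb{S}^{n-1}\big)+\omega^2\big(\mathcal{T}_g(v^\star)\cap\mathbb{S}^{m-1}\big).$$ Let $\epsilon\ge 0$. 1. If $\sqrt m\ge\sqrt{\mathscr{C}_p}+\sqrt 2+\epsilon$, then with probability at least $1-2\exp(-\epsilon^2/4)$ both programs (I) and (II) succeed. 2. If $\sqrt m\le\sqrt{\mathscr{C}_p}-\epsilon$, then with probability at least $1-2\exp(-\epsilon^2/4)$ both programs (I) and (II) fail. -/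

import Mathlib

open MeasureTheory ProbabilityTheory

namespace CorruptedSensing

/-- A proper convex function `f : E → (-∞, +∞]`: it never takes the value `-∞`, is not identically
`+∞`, and its epigraph is convex. -/
structure IsProperConvex {E : Type*} [AddCommGroup E] [Module ℝ E] (f : E → EReal) : Prop where
  ne_bot : ∀ x, f x ≠ ⊥
  exists_ne_top : ∃ x, f x ≠ ⊤
  convex_epigraph : Convex ℝ {p : E × ℝ | f p.1 ≤ (p.2 : EReal)}

/-- The tangent cone of `f` at `x`, i.e. the set of descent directions (no closure is taken). -/
def tangentCone {E : Type*} [AddCommGroup E] [Module ℝ E] (f : E → EReal) (x : E) : Set E :=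
  {u | ∃ t : ℝ, 0 < t ∧ f (x + t • u) ≤ f x}

/-- The Gaussian width `𝔼 sup_{x ∈ S} ⟨g, x⟩` with `g` a standard Gaussian vector in `ℝᵈ`.
It is used only for subsets of the unit sphere, where the supremum is bounded by `‖g‖`;
the width of the empty set is `0`. -/
noncomputable def gaussianWidth {d : ℕ} (S : Set (EuclideanSpace ℝ (Fin d))) : ℝ :=
  ∫ g, (⨆ x : S, inner ℝ g (x : EuclideanSpace ℝ (Fin d)))
    ∂(stdGaussian (EuclideanSpace ℝ (Fin d)))

/-- The spherical Gaussian width of a cone: the Gaussian width of its intersection with the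
unit sphere. -/
noncomputable def sphericalWidth {d : ℕ} (C : Set (EuclideanSpace ℝ (Fin d))) : ℝ :=
  gaussianWidth (C ∩ Metric.sphere 0 1)

/-- The critical point `ω²(T_f(x⋆) ∩ 𝕊ⁿ⁻¹) + ω²(T_g(v⋆) ∩ 𝕊ᵐ⁻¹)`. -/
noncomputable def criticalPoint {n m : ℕ}
    (f : EuclideanSpace ℝ (Fin n) → EReal) (g : EuclideanSpace ℝ (Fin m) → EReal)
    (xs : EuclideanSpace ℝ (Fin n)) (vs : EuclideanSpace ℝ (Fin m)) : ℝ :=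
  sphericalWidth (tangentCone f xs) ^ 2 + sphericalWidth (tangentCone g vs) ^ 2

/-- `Φ` is a random `m × n` matrix with independent standard normal entries. -/
structure IsGaussianMatrix {Ω : Type*} [MeasurableSpace Ω] {m n : ℕ}
    (Φ : Ω → Matrix (Fin m) (Fin n) ℝ) (P : Measure Ω) : Prop where
  hasLaw_entry : ∀ i j, HasLaw (fun ω => Φ ω i j) (gaussianReal 0 1) P
  indep : iIndepFun (fun (ij : Fin m × Fin n) (ω : Ω) => Φ ω ij.1 ij.2) P

/-- The measurement `Φ x + √m v` in `ℝᵐ`. -/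
noncomputable def measurement {m n : ℕ} (Φ : Matrix (Fin m) (Fin n) ℝ)
    (x : EuclideanSpace ℝ (Fin n)) (v : EuclideanSpace ℝ (Fin m)) : EuclideanSpace ℝ (Fin m) :=
  Matrix.toEuclideanLin Φ x + Real.sqrt m • v

/-- The set of optimal solutions of `min obj(p)` subject to `p ∈ F`. -/
def solutionSet {α : Type*} (F : Set α) (obj : α → EReal) : Set α :=
  {p | p ∈ F ∧ ∀ q ∈ F, obj p ≤ obj q}

/-- The program `min f(x)` subject to `y = Φ x + √m v`, `g(v) ≤ g(v⋆)`, run on the data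
`y = Φ x⋆ + √m v⋆`, succeeds: `(x⋆, v⋆)` is its unique optimal solution. -/
def Succeeds₁ {n m : ℕ}
    (f : EuclideanSpace ℝ (Fin n) → EReal) (g : EuclideanSpace ℝ (Fin m) → EReal)
    (xs : EuclideanSpace ℝ (Fin n)) (vs : EuclideanSpace ℝ (Fin m))
    (Φ : Matrix (Fin m) (Fin n) ℝ) : Prop :=
  solutionSet
    {p : EuclideanSpace ℝ (Fin n) × EuclideanSpace ℝ (Fin m) |
      measurement Φ xs vs = measurement Φ p.1 p.2 ∧ g p.2 ≤ g vs}
    (fun p => f p.1) = {(xs, vs)}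

/-- The program `min g(v)` subject to `y = Φ x + √m v`, `f(x) ≤ f(x⋆)`, run on the data
`y = Φ x⋆ + √m v⋆`, succeeds: `(x⋆, v⋆)` is its unique optimal solution. -/
def Succeeds₂ {n m : ℕ}
    (f : EuclideanSpace ℝ (Fin n) → EReal) (g : EuclideanSpace ℝ (Fin m) → EReal)
    (xs : EuclideanSpace ℝ (Fin n)) (vs : EuclideanSpace ℝ (Fin m))
    (Φ : Matrix (Fin m) (Fin n) ℝ) : Prop :=
  solutionSet
    {p : EuclideanSpace ℝ (Fin n) × EuclideanSpace ℝ (Fin m) |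
      measurement Φ xs vs = measurement Φ p.1 p.2 ∧ f p.1 ≤ f xs}
    (fun p => g p.2) = {(xs, vs)}

end CorruptedSensing

/-!
Let `C` and `K` be the tangent cones of `f` at `x⋆` and of `g` at `v⋆`. By convexity, descent along
a direction persists for shorter steps, so either program fails for the matrix `Φ` exactly when
`Φ c + k = 0` for some `c ∈ C`, `k ∈ K` that are not both zero
(`succeeds₁_iff_not_hasRelation`, `succeeds₂_iff_not_hasRelation`). Such relations are controlled
by one inequality of Gordon type, `gaussianPi_exists_polar_le`: if `A` and `U` are subsets of unit
spheres with `ω(U) ≥ ω(A) + ε`, then, with probability at least `1 - exp (-ε² / 2)`, there is no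
`a ∈ A` such that `⟪Φ a, u⟫ ≤ 0` for all `u ∈ U`.

Success. A nontrivial relation provides a unit vector `c ∈ C` with `-Φ c ∈ K`, hence with
`⟪Φ c, -p⟫ ≤ 0` for every `p` in the polar cone `K°`. So the inequality applies to `C` and `-K°`
as soon as `ω(K°) ≥ ω(C) + ε`, all widths being those of the unit vectors of the cones.

Failure. If `C` or `K` is not a linear subspace, then the absence of nontrivial relations yields,
by separation, a unit vector `u ∈ K°` with `⟪Φ c, u⟫ ≤ 0` for all `c ∈ C`
(`exists_relation_of_not_neg`), and the inequality applies to the transpose of `Φ`, with `K°` and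
`C`, as soon as `ω(C) ≥ ω(K°) + ε`. If both are subspaces, then `ω(V)² ≤ dim V` and a dimension
count produces a nontrivial relation for every `Φ`.

The widths of a closed cone and of its polar are related by
`m - 2 ≤ ω(K)² + ω(K°)² ≤ m` (`dim_le_width_sq_add`, `width_sq_add_le_dim`). By Moreau's
decomposition, `‖z‖²` is the sum of the squared distances of `z` to `K°` and to `K`, and these
distances are the positive parts of the support functions of the unit vectors of `K` and of `K°`.
The expectation of the square of such a support function exceeds `ω²` by its variance, which is at
most one (`integral_supInner_sq_le`). The defect `2` is the origin of the term `√2`.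

The inequality of Gordon type, and with it the bound on the variance, follows from an estimate of
exponential moments, `integral_exp_neg_minMax_bilinProc_le`: for finite `A` and `U`,
`𝔼 exp (-λ min_a max_u ⟪Φ a, u⟫) ≤ exp (λ² / 2 - λ (ω(U) - ω(A)))`. It is proved by Gaussian
interpolation between the vector in which the process `⟪Φ a, u⟫` is repeated `k` times and `k`
independent copies, the replicas, of the process `⟪g, a⟫ + ⟪h, u⟫`, applied to a smooth version of
`exp (-p ∑ᵢ min_a max_u)`, where `i` runs over the replicas. In the derivative along the
interpolation, the second derivatives within a replica that do not come from the outer exponential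
enter with the sign of Gordon's comparison; those of the outer exponential cost a factor that tends
to `exp (λ² / 2)`. Each replica contributes an exponential moment of order `λ / k`, and the `k`-th
power of this moment tends to the exponential of `-λ` times the mean, which is `ω(U) - ω(A)`.
Markov's inequality at `λ = ε` gives the tail `exp (-ε² / 2)`, and arbitrary `A` and `U` are reached
through finite nets.
-/

namespace CorruptedSensing

/-! ### Integration by parts for the standard Gaussian measure on `κ → ℝ` -/

section GaussianCalculus

variable {κ ι : Type*} [Fintype κ] [Fintype ι]

/-- The law of a family of independent standard normal variables indexed by `κ`. -/
noncomputable abbrev gaussianPi (κ : Type*) [Fintype κ] : Measure (κ → ℝ) :=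
  Measure.pi fun _ => gaussianReal 0 1

/-- Integrable envelope for all functions integrated below: they grow at most exponentially in the
`ℓ¹` norm. -/
lemma integrable_exp_sum_abs (c : ℝ) :
    Integrable (fun z : κ → ℝ => Real.exp (c * ∑ k, |z k|)) (gaussianPi κ) := by
  have h1 : Integrable (fun t : ℝ => Real.exp (c * |t|)) (gaussianReal 0 1) := by
    refine Integrable.mono' ((integrable_exp_mul_gaussianReal (μ := 0) (v := 1) c).add
      (integrable_exp_mul_gaussianReal (μ := 0) (v := 1) (-c)))
      (by fun_prop) (Filter.Eventually.of_forall fun t => ?_)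
    rw [Real.norm_eq_abs, abs_of_pos (Real.exp_pos _)]
    simp only [Pi.add_apply]
    rcases abs_cases t with ⟨h, _⟩ | ⟨h, _⟩ <;> rw [h]
    · linarith [Real.exp_pos (-c * t)]
    · rw [show c * -t = -c * t by ring]
      linarith [Real.exp_pos (c * t)]
  have := Integrable.fintype_prod (ι := κ) (fun _ => h1)
  refine this.congr (Filter.Eventually.of_forall fun z => ?_)
  simp only [← Real.exp_sum, Finset.mul_sum]

lemma integrable_of_abs_le_exp {g : (κ → ℝ) → ℝ} {C c : ℝ} (hg : Continuous g)
    (hb : ∀ z, |g z| ≤ C * Real.exp (c * ∑ k, |z k|)) : Integrable g (gaussianPi κ) :=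
  Integrable.mono' ((integrable_exp_sum_abs c).const_mul C) hg.aestronglyMeasurable
    (Filter.Eventually.of_forall hb)

/-- Stein's identity for the standard normal distribution. -/
lemma integral_id_mul_gaussianReal {u u' : ℝ → ℝ} (hu : ∀ t, HasDerivAt u (u' t) t)
    (i0 : Integrable u (gaussianReal 0 1)) (i1 : Integrable u' (gaussianReal 0 1))
    (i2 : Integrable (fun t => t * u t) (gaussianReal 0 1)) :
    ∫ t, t * u t ∂(gaussianReal 0 1) = ∫ t, u' t ∂(gaussianReal 0 1) := by
  have hpdf : ∀ t, HasDerivAt (gaussianPDFReal 0 1) (-t * gaussianPDFReal 0 1 t) t := by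
    intro t
    unfold gaussianPDFReal
    have : HasDerivAt (fun x : ℝ => -(x - 0) ^ 2 / (2 * ((1 : NNReal) : ℝ))) (-t) t := by
      have := (((hasDerivAt_id t).sub_const 0).pow 2).neg.div_const (2 * ((1 : NNReal) : ℝ))
      convert! this using 1
      simp
      ring
    convert! (this.exp.const_mul ((√(2 * Real.pi * ((1 : NNReal) : ℝ)))⁻¹)) using 1
    ring
  have key : ∀ w : ℝ → ℝ, Integrable w (gaussianReal 0 1) →
      Integrable (fun t => gaussianPDFReal 0 1 t * w t) := by
    intro w hw
    rw [gaussianReal_of_var_ne_zero 0 one_ne_zero,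
      integrable_withDensity_iff_integrable_smul₀'
        (measurable_gaussianPDF 0 1).aemeasurable
        (Filter.Eventually.of_forall fun _ => gaussianPDF_lt_top)] at hw
    simpa [toReal_gaussianPDF] using hw
  rw [integral_gaussianReal_eq_integral_smul one_ne_zero,
    integral_gaussianReal_eq_integral_smul one_ne_zero]
  have := integral_mul_deriv_eq_deriv_mul_of_integrable (u := gaussianPDFReal 0 1)
    (u' := fun t => -t * gaussianPDFReal 0 1 t) (v := u) (v' := u')
    (fun x _ => hpdf x) (fun x _ => hu x) (key _ i1)
    (by
      refine (key _ i2).neg.congr (Filter.Eventually.of_forall fun t => ?_)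
      simp only [Pi.neg_apply, Pi.mul_apply]
      ring) (key _ i0)
  simp only [smul_eq_mul]
  rw [this, ← integral_neg]
  congr 1
  ext t
  ring

/-- Resampling one coordinate preserves the Gaussian measure. -/
lemma map_update_gaussianPi [DecidableEq κ] (k : κ) :
    ((gaussianReal 0 1).prod (gaussianPi κ)).map
      (fun q : ℝ × (κ → ℝ) => Function.update q.2 k q.1) = gaussianPi κ := by
  symm
  refine Measure.pi_eq fun s hs => ?_
  have hm : Measurable fun q : ℝ × (κ → ℝ) => Function.update q.2 k q.1 := by
    refine measurable_pi_iff.2 fun j => ?_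
    by_cases h : j = k
    · subst h
      simpa using measurable_fst
    · simp only [Function.update_of_ne h]
      fun_prop
  rw [Measure.map_apply hm (MeasurableSet.univ_pi hs)]
  have : (fun q : ℝ × (κ → ℝ) => Function.update q.2 k q.1) ⁻¹' Set.univ.pi s
      = s k ×ˢ Set.univ.pi (Function.update s k Set.univ) := by
    ext q
    simp only [Set.mem_preimage, Set.mem_pi, Set.mem_univ, true_implies, Set.mem_prod]
    constructor
    · intro h
      refine ⟨by simpa using h k, fun j => ?_⟩
      by_cases hj : j = k
      · subst hj; simp
      · simpa [Function.update_of_ne hj] using h j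
    · rintro ⟨h1, h2⟩ j
      by_cases hj : j = k
      · subst hj; simpa using h1
      · simpa [Function.update_of_ne hj] using h2 j
  rw [this, Measure.prod_prod, Measure.pi_pi, ← Finset.mul_prod_erase _ _ (Finset.mem_univ k),
    ← Finset.mul_prod_erase _ (fun i => (gaussianReal 0 1) (s i)) (Finset.mem_univ k)]
  simp only [Function.update_self, measure_univ, one_mul]
  congr 1
  refine Finset.prod_congr rfl fun j hj => ?_
  rw [Function.update_of_ne (Finset.ne_of_mem_erase hj)]

/-- Gaussian integration by parts in the coordinate `k`. -/
lemma integral_coord_mul_gaussianPi [DecidableEq κ] (k : κ) {φ φ' : (κ → ℝ) → ℝ}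
    (hd : ∀ z, HasDerivAt (fun t => φ (Function.update z k t)) (φ' z) (z k))
    (i0 : Integrable φ (gaussianPi κ)) (i1 : Integrable φ' (gaussianPi κ))
    (i2 : Integrable (fun z => z k * φ z) (gaussianPi κ)) :
    ∫ z, z k * φ z ∂(gaussianPi κ) = ∫ z, φ' z ∂(gaussianPi κ) := by
  have hm : AEMeasurable (fun q : ℝ × (κ → ℝ) => Function.update q.2 k q.1)
      ((gaussianReal 0 1).prod (gaussianPi κ)) := by
    refine AEMeasurable.of_map_ne_zero ?_
    rw [map_update_gaussianPi k]
    exact IsProbabilityMeasure.ne_zero _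
  have swap : ∀ w : (κ → ℝ) → ℝ, Integrable w (gaussianPi κ) →
      Integrable (fun q : ℝ × (κ → ℝ) => w (Function.update q.2 k q.1))
        ((gaussianReal 0 1).prod (gaussianPi κ)) := by
    intro w hw
    rw [← map_update_gaussianPi k] at hw
    exact hw.comp_aemeasurable hm
  have fub : ∀ w : (κ → ℝ) → ℝ, Integrable w (gaussianPi κ) →
      ∫ z, w z ∂(gaussianPi κ)
        = ∫ z, ∫ t, w (Function.update z k t) ∂(gaussianReal 0 1) ∂(gaussianPi κ) := by
    intro w hw
    have hw' := hw.aestronglyMeasurable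
    rw [← map_update_gaussianPi k] at hw'
    conv_lhs => rw [← map_update_gaussianPi k]
    rw [integral_map hm hw', integral_prod_symm _ (swap w hw)]
  rw [fub _ i2, fub _ i1]
  refine integral_congr_ae ?_
  filter_upwards [(swap _ i0).prod_left_ae, (swap _ i1).prod_left_ae, (swap _ i2).prod_left_ae]
    with z h0 h1 h2
  simp only [Function.update_self] at h2 ⊢
  refine integral_id_mul_gaussianReal (fun t => ?_) h0 h1 h2
  simpa using hd (Function.update z k t)

/-! ### Gaussian interpolation -/

/-- `D` is the gradient of `f`, expressed through the chain rule along differentiable curves. -/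
def HasGradient (f : (ι → ℝ) → ℝ) (D : ι → (ι → ℝ) → ℝ) : Prop :=
  ∀ (W : ℝ → ι → ℝ) (W' : ι → ℝ) (t : ℝ), (∀ i, HasDerivAt (fun s => W s i) (W' i) t) →
    HasDerivAt (fun s => f (W s)) (∑ i, D i (W t) * W' i) t

lemma sum_abs_mulVec_le (M : Matrix ι κ ℝ) (z : κ → ℝ) :
    ∑ i, |M.mulVec z i| ≤ (∑ i, ∑ k, |M i k|) * ∑ k, |z k| := by
  rw [Finset.sum_mul]
  refine Finset.sum_le_sum fun i _ => ?_
  rw [Finset.sum_mul]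
  refine (Finset.abs_sum_le_sum_abs _ _).trans (Finset.sum_le_sum fun k _ => ?_)
  rw [abs_mul]
  gcongr
  exact Finset.single_le_sum (f := fun k => |z k|) (fun _ _ => abs_nonneg _) (Finset.mem_univ k)

lemma integral_sum_sum {Ω : Type*} [MeasurableSpace Ω] {μ : Measure Ω} {F : ι → κ → Ω → ℝ}
    (hF : ∀ i k, Integrable (F i k) μ) :
    ∫ z, ∑ i, ∑ k, F i k z ∂μ = ∑ i, ∑ k, ∫ z, F i k z ∂μ := by
  rw [integral_finsetSum _ fun i _ => integrable_finsetSum _ fun k _ => hF i k]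
  exact Finset.sum_congr rfl fun i _ => integral_finsetSum _ fun k _ => hF i k

/-- Comparison of two uncorrelated Gaussian vectors `A z` and `B z` by rotating one into the other:
if the covariance difference contracted with the Hessian `D2` of `f` is at most `a • f`, then
`𝔼 f (A z) ≤ exp (a / 2) 𝔼 f (B z)`. -/
theorem integral_mulVec_le_of_hessian_le [DecidableEq κ] (A B : Matrix ι κ ℝ)
    (hAB : A * B.transpose = 0)
    {f : (ι → ℝ) → ℝ} {D : ι → (ι → ℝ) → ℝ} {D2 : ι → ι → (ι → ℝ) → ℝ}
    (hf : HasGradient f D) (hD : ∀ i, HasGradient (D i) (D2 i))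
    (cf : Continuous f) (cD : ∀ i, Continuous (D i)) (cD2 : ∀ i j, Continuous (D2 i j))
    {C c : ℝ} (hc : 0 ≤ c) (bf : ∀ x, |f x| ≤ C * Real.exp (c * ∑ i, |x i|))
    (bD : ∀ i x, |D i x| ≤ C * Real.exp (c * ∑ i, |x i|))
    (bD2 : ∀ i j x, |D2 i j x| ≤ C * Real.exp (c * ∑ i, |x i|))
    {a : ℝ} (ha : ∀ x, ∑ i, ∑ j, (A * A.transpose - B * B.transpose) i j * D2 i j x ≤ a * f x) :
    ∫ z, f (A.mulVec z) ∂(gaussianPi κ)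
      ≤ Real.exp (a / 2) * ∫ z, f (B.mulVec z) ∂(gaussianPi κ) := by
  have hC : 0 ≤ C := by
    have := (abs_nonneg _).trans (bf 0)
    exact nonneg_of_mul_nonneg_left this (Real.exp_pos _)
  set M : ℝ → Matrix ι κ ℝ := fun θ => Real.cos θ • A + Real.sin θ • B with hM
  set M' : ℝ → Matrix ι κ ℝ := fun θ => -Real.sin θ • A + Real.cos θ • B with hM'
  set R : ℝ := ∑ i, ∑ k, (|A i k| + |B i k|) with hR
  have hR0 : 0 ≤ R := by positivity
  have entry : ∀ s t : ℝ, |s| ≤ 1 → |t| ≤ 1 → ∀ i k,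
      |(s • A + t • B) i k| ≤ |A i k| + |B i k| := by
    intro s t hs ht i k
    simp only [Matrix.add_apply, Matrix.smul_apply, smul_eq_mul]
    refine (abs_add_le _ _).trans ?_
    rw [abs_mul, abs_mul]
    exact add_le_add (mul_le_of_le_one_left (abs_nonneg _) hs)
      (mul_le_of_le_one_left (abs_nonneg _) ht)
  have MR : ∀ s t : ℝ, |s| ≤ 1 → |t| ≤ 1 → ∀ z : κ → ℝ,
      ∑ i, |(s • A + t • B).mulVec z i| ≤ R * ∑ k, |z k| := by
    intro s t hs ht z
    refine (sum_abs_mulVec_le _ z).trans ?_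
    refine mul_le_mul_of_nonneg_right ?_ (by positivity)
    exact Finset.sum_le_sum fun i _ => Finset.sum_le_sum fun k _ => entry s t hs ht i k
  have MRθ : ∀ θ z, ∑ i, |(M θ).mulVec z i| ≤ R * ∑ k, |z k| := fun θ z =>
    MR _ _ (Real.abs_cos_le_one θ) (Real.abs_sin_le_one θ) z
  have MRθ' : ∀ θ z, ∑ i, |(M' θ).mulVec z i| ≤ R * ∑ k, |z k| := fun θ z =>
    MR _ _ (by rw [abs_neg]; exact Real.abs_sin_le_one θ) (Real.abs_cos_le_one θ) z
  have cM : ∀ (N : Matrix ι κ ℝ), Continuous fun z : κ → ℝ => N.mulVec z := fun N => by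
    fun_prop
  have grow : ∀ (g : (ι → ℝ) → ℝ), (∀ x, |g x| ≤ C * Real.exp (c * ∑ i, |x i|)) →
      ∀ θ z, |g ((M θ).mulVec z)| ≤ C * Real.exp ((c * R) * ∑ k, |z k|) := by
    intro g hg θ z
    refine (hg _).trans ?_
    rw [mul_assoc]
    gcongr
    exact MRθ θ z
  have absorb : ∀ z : κ → ℝ, ∀ r ≤ ∑ k, |z k|,
      r * Real.exp ((c * R) * ∑ k, |z k|) ≤ Real.exp ((c * R + 1) * ∑ k, |z k|) := by
    intro z r hr
    rw [add_mul, one_mul, Real.exp_add, mul_comm]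
    gcongr
    linarith [Real.add_one_le_exp (∑ k, |z k|)]
  set H : ℝ → ℝ := fun θ => ∫ z, f ((M θ).mulVec z) ∂(gaussianPi κ) with hH
  have dW : ∀ z θ i, HasDerivAt (fun s => (M s).mulVec z i) ((M' θ).mulVec z i) θ := by
    intro z θ i
    have e : ∀ s t : ℝ, (s • A + t • B).mulVec z i = s * A.mulVec z i + t * B.mulVec z i := by
      intro s t
      simp [Matrix.add_mulVec, Matrix.smul_mulVec]
    simp only [hM, hM', e]
    exact ((Real.hasDerivAt_cos θ).mul_const _).add ((Real.hasDerivAt_sin θ).mul_const _)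
  have iD : ∀ i θ, Integrable (fun z => D i ((M θ).mulVec z)) (gaussianPi κ) := fun i θ =>
    integrable_of_abs_le_exp ((cD i).comp (cM _)) (grow _ (bD i) θ)
  have iD2 : ∀ i j θ, Integrable (fun z => D2 i j ((M θ).mulVec z)) (gaussianPi κ) :=
    fun i j θ => integrable_of_abs_le_exp ((cD2 i j).comp (cM _)) (grow _ (bD2 i j) θ)
  have izD : ∀ i k θ, Integrable (fun z => z k * D i ((M θ).mulVec z)) (gaussianPi κ) := by
    intro i k θ
    refine integrable_of_abs_le_exp (C := C) (c := c * R + 1)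
      ((continuous_apply k).mul ((cD i).comp (cM _))) fun z => ?_
    rw [abs_mul]
    calc |z k| * |D i ((M θ).mulVec z)|
        ≤ |z k| * (C * Real.exp ((c * R) * ∑ k, |z k|)) := by
          gcongr
          exact grow _ (bD i) θ z
      _ = C * (|z k| * Real.exp ((c * R) * ∑ k, |z k|)) := by ring
      _ ≤ _ := by
          gcongr
          exact absorb z _ (Finset.single_le_sum (f := fun k => |z k|)
            (fun _ _ => abs_nonneg _) (Finset.mem_univ k))
  have ibp : ∀ i k θ, ∫ z, z k * D i ((M θ).mulVec z) ∂(gaussianPi κ)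
      = ∫ z, ∑ j, D2 i j ((M θ).mulVec z) * M θ j k ∂(gaussianPi κ) := by
    intro i k θ
    refine integral_coord_mul_gaussianPi k (φ := fun z => D i ((M θ).mulVec z)) (fun z => ?_)
      (iD i θ) (integrable_finsetSum _ fun j _ => (iD2 i j θ).mul_const _) (izD i k θ)
    have h := hD i (fun t => (M θ).mulVec (Function.update z k t)) (fun j => M θ j k) (z k)
      (fun j => by
        have h2 := hasDerivAt_pi.1 (hasDerivAt_update z k (z k))
        have h3 := HasDerivAt.fun_sum (u := Finset.univ)
          (fun l (_ : l ∈ Finset.univ) => (h2 l).const_mul (M θ j l))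
        convert! h3 using 1
        simp [Pi.single_apply])
    simpa using h
  have hder : ∀ θ, HasDerivAt H
      (∫ z, ∑ i, D i ((M θ).mulVec z) * (M' θ).mulVec z i ∂(gaussianPi κ)) θ := by
    intro θ
    refine (hasDerivAt_integral_of_dominated_loc_of_deriv_le (μ := gaussianPi κ)
      (F := fun θ z => f ((M θ).mulVec z))
      (F' := fun θ z => ∑ i, D i ((M θ).mulVec z) * (M' θ).mulVec z i)
      (bound := fun z => C * R * Real.exp ((c * R + 1) * ∑ k, |z k|)) (s := Set.univ)
      Filter.univ_mem ?_ ?_ ?_ ?_ ?_ ?_).2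
    · exact Filter.Eventually.of_forall fun θ => (cf.comp (cM _)).aestronglyMeasurable
    · exact integrable_of_abs_le_exp (cf.comp (cM _)) (grow _ bf θ)
    · refine Continuous.aestronglyMeasurable (continuous_finsetSum _ fun i _ => ?_)
      exact ((cD i).comp (cM _)).mul ((continuous_apply i).comp (cM _))
    · refine Filter.Eventually.of_forall fun z θ _ => ?_
      rw [Real.norm_eq_abs]
      calc |∑ i, D i ((M θ).mulVec z) * (M' θ).mulVec z i|
          ≤ ∑ i, (C * Real.exp ((c * R) * ∑ k, |z k|)) * |(M' θ).mulVec z i| := by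
            refine (Finset.abs_sum_le_sum_abs _ _).trans (Finset.sum_le_sum fun i _ => ?_)
            rw [abs_mul]
            gcongr
            exact grow _ (bD i) θ z
        _ = (C * Real.exp ((c * R) * ∑ k, |z k|)) * ∑ i, |(M' θ).mulVec z i| :=
            (Finset.mul_sum _ _ _).symm
        _ ≤ (C * Real.exp ((c * R) * ∑ k, |z k|)) * (R * ∑ k, |z k|) := by
            gcongr
            exact MRθ' θ z
        _ = C * R * ((∑ k, |z k|) * Real.exp ((c * R) * ∑ k, |z k|)) := by ring
        _ ≤ _ := by
            gcongr
            exact absorb z _ le_rfl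
    · exact (integrable_exp_sum_abs _).const_mul _
    · exact Filter.Eventually.of_forall fun z θ _ =>
        hf (fun s => (M s).mulVec z) _ θ (fun i => dW z θ i)
  have hMM : ∀ θ, M' θ * (M θ).transpose
      = (-(Real.sin θ * Real.cos θ)) • (A * A.transpose - B * B.transpose) := by
    intro θ
    have hBA : B * A.transpose = 0 := by
      have := congrArg Matrix.transpose hAB
      simpa [Matrix.transpose_mul] using this
    simp only [hM, hM', Matrix.transpose_add, Matrix.transpose_smul, Matrix.add_mul,
      Matrix.mul_add, Matrix.smul_mul, Matrix.mul_smul, hAB, hBA, smul_zero, add_zero, zero_add,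
      smul_smul, smul_sub]
    rw [neg_smul, ← sub_eq_zero]
    module
  have hder' : ∀ θ, (∫ z, ∑ i, D i ((M θ).mulVec z) * (M' θ).mulVec z i ∂(gaussianPi κ))
      = -(Real.sin θ * Real.cos θ) * ∫ z, ∑ i, ∑ j,
        (A * A.transpose - B * B.transpose) i j * D2 i j ((M θ).mulVec z) ∂(gaussianPi κ) := by
    intro θ
    calc (∫ z, ∑ i, D i ((M θ).mulVec z) * (M' θ).mulVec z i ∂(gaussianPi κ))
        = ∫ z, ∑ i, ∑ k, M' θ i k * (z k * D i ((M θ).mulVec z)) ∂(gaussianPi κ) := by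
          congr 1
          ext z
          refine Finset.sum_congr rfl fun i _ => ?_
          rw [Matrix.mulVec, dotProduct, Finset.mul_sum]
          exact Finset.sum_congr rfl fun k _ => by ring
      _ = ∑ i, ∑ k, M' θ i k * ∫ z, ∑ j, D2 i j ((M θ).mulVec z) * M θ j k ∂(gaussianPi κ) := by
          refine (integral_sum_sum (F := fun i k z => M' θ i k * (z k * D i ((M θ).mulVec z)))
            fun i k => (izD i k θ).const_mul _).trans ?_
          refine Finset.sum_congr rfl fun i _ => Finset.sum_congr rfl fun k _ => ?_
          rw [integral_const_mul, ibp]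
      _ = ∑ i, ∑ j, (M' θ * (M θ).transpose) i j * ∫ z, D2 i j ((M θ).mulVec z)
            ∂(gaussianPi κ) := by
          refine Finset.sum_congr rfl fun i _ => ?_
          simp_rw [integral_finsetSum Finset.univ fun j _ => (iD2 i j θ).mul_const _,
            integral_mul_const, Matrix.mul_apply, Matrix.transpose_apply, Finset.mul_sum,
            Finset.sum_mul]
          rw [Finset.sum_comm]
          refine Finset.sum_congr rfl fun j _ => Finset.sum_congr rfl fun k _ => by ring
      _ = _ := by
          refine Eq.trans ?_ (congrArg (-(Real.sin θ * Real.cos θ) * ·) (integral_sum_sum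
            (F := fun i j z => (A * A.transpose - B * B.transpose) i j * D2 i j ((M θ).mulVec z))
            fun i j => (iD2 i j θ).const_mul _).symm)
          simp only [Finset.mul_sum]
          refine Finset.sum_congr rfl fun i _ => Finset.sum_congr rfl fun j _ => ?_
          rw [integral_const_mul, hMM, Matrix.smul_apply, smul_eq_mul, mul_assoc]
  have hbound : ∀ θ, ∫ z, ∑ i, ∑ j,
      (A * A.transpose - B * B.transpose) i j * D2 i j ((M θ).mulVec z) ∂(gaussianPi κ)
      ≤ a * H θ := by
    intro θ
    rw [hH, ← integral_const_mul]
    exact integral_mono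
      (integrable_finsetSum _ fun i _ => integrable_finsetSum _ fun j _ =>
        (iD2 i j θ).const_mul _)
      ((integrable_of_abs_le_exp (cf.comp (cM _)) (grow _ bf θ)).const_mul _)
      (fun z => ha _)
  -- `θ ↦ H θ * exp (a sin² θ / 2)` is nondecreasing on `[0, π / 2]`.
  set E : ℝ → ℝ := fun θ => H θ * Real.exp (a / 2 * Real.sin θ ^ 2) with hE
  have dE : ∀ θ, HasDerivAt E (-(Real.sin θ * Real.cos θ) * (∫ z, ∑ i, ∑ j,
        (A * A.transpose - B * B.transpose) i j * D2 i j ((M θ).mulVec z) ∂(gaussianPi κ)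
          - a * H θ) * Real.exp (a / 2 * Real.sin θ ^ 2)) θ := by
    intro θ
    have h1 := (((Real.hasDerivAt_sin θ).pow 2).const_mul (a / 2)).exp
    have h2 := (hder θ).mul h1
    rw [hder' θ] at h2
    convert! h2 using 1
    simp
    ring
  have mono : MonotoneOn E (Set.Icc 0 (Real.pi / 2)) := by
    refine monotoneOn_of_deriv_nonneg (convex_Icc _ _)
      (fun θ _ => (dE θ).continuousAt.continuousWithinAt)
      (fun θ _ => (dE θ).differentiableAt.differentiableWithinAt) fun θ hθ => ?_
    rw [interior_Icc] at hθ
    rw [(dE θ).deriv]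
    have hs : 0 ≤ Real.sin θ :=
      Real.sin_nonneg_of_nonneg_of_le_pi hθ.1.le (by linarith [hθ.2, Real.pi_pos])
    have hcos : 0 ≤ Real.cos θ :=
      Real.cos_nonneg_of_neg_pi_div_two_le_of_le (by linarith [hθ.1, Real.pi_pos]) hθ.2.le
    refine mul_nonneg ?_ (Real.exp_pos _).le
    rw [neg_mul, ← mul_neg]
    exact mul_nonneg (mul_nonneg hs hcos) (by linarith [hbound θ])
  have fin := mono (Set.left_mem_Icc.2 (by positivity)) (Set.right_mem_Icc.2 (by positivity))
    (by positivity : (0 : ℝ) ≤ Real.pi / 2)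
  simp only [hE, hH, hM, Real.cos_zero, Real.sin_zero, Real.cos_pi_div_two, Real.sin_pi_div_two,
    one_smul, zero_smul, add_zero, zero_add] at fin
  simpa [mul_comm] using fin

end GaussianCalculus

/-! ### A smooth surrogate for minima of maxima -/

section SoftMinMax

set_option linter.unusedSectionVars false

variable {K I J : Type*} [Fintype K] [Fintype I] [Fintype J]

/-- `∑ᵤ exp x(i,a,u)`: its logarithm is a smooth version of `maxᵤ x(i,a,u)`. -/
noncomputable def expSum (x : K × I × J → ℝ) (i : K) (a : I) : ℝ := ∑ u, Real.exp (x (i, a, u))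

/-- `∑ₐ 1 / ∑ᵤ exp x(i,a,u)`: minus its logarithm is a smooth version of
`minₐ maxᵤ x(i,a,u)`. -/
noncomputable def invExpSum (x : K × I × J → ℝ) (i : K) : ℝ := ∑ a, (expSum x i a)⁻¹

/-- Smooth version of `exp (-p ∑ᵢ minₐ maxᵤ x(i,a,u))`. The index `i` runs over the replicas used
to turn an exponential moment into the exponential of a mean. -/
noncomputable def softMinMax (p : ℝ) (x : K × I × J → ℝ) : ℝ :=
  Real.exp (p * ∑ i, Real.log (invExpSum x i))

/-- The Gibbs weight of `(a, u)` within replica `i`; these sum to one over `(a, u)`. -/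
noncomputable def gibbsWeight (q : K × I × J) (x : K × I × J → ℝ) : ℝ :=
  Real.exp (x q) / (expSum x q.1 q.2.1 ^ 2 * invExpSum x q.1)

/-- The Gibbs weight of `u` for fixed `(i, a)`; these sum to one over `u`. -/
noncomputable def condWeight (q : K × I × J) (x : K × I × J → ℝ) : ℝ :=
  Real.exp (x q) / expSum x q.1 q.2.1

/-- The gradient of `softMinMax p`. -/
noncomputable def softGrad (p : ℝ) (q : K × I × J) (x : K × I × J → ℝ) : ℝ :=
  -p * softMinMax p x * gibbsWeight q x

open Classical in
/-- The Hessian of `softMinMax p`. -/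
noncomputable def softHess (p : ℝ) (q r : K × I × J) (x : K × I × J → ℝ) : ℝ :=
  -p * softMinMax p x * gibbsWeight q x *
    (-p * gibbsWeight r x + (if q = r then 1 else 0)
      - 2 * (if q.1 = r.1 then if q.2.1 = r.2.1 then condWeight r x else 0 else 0)
      + (if q.1 = r.1 then gibbsWeight r x else 0))

lemma expSum_pos [Nonempty J] (x : K × I × J → ℝ) (i : K) (a : I) : 0 < expSum x i a :=
  Finset.sum_pos (fun _ _ => Real.exp_pos _) Finset.univ_nonempty

lemma invExpSum_pos [Nonempty I] [Nonempty J] (x : K × I × J → ℝ) (i : K) :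
    0 < invExpSum x i :=
  Finset.sum_pos (fun _ _ => inv_pos.2 (expSum_pos _ _ _)) Finset.univ_nonempty

lemma softMinMax_pos (p : ℝ) (x : K × I × J → ℝ) : 0 < softMinMax p x := Real.exp_pos _

lemma continuous_expSum (i : K) (a : I) :
    Continuous fun x : K × I × J → ℝ => expSum x i a := by
  unfold expSum
  fun_prop

variable [Nonempty J]

lemma continuous_invExpSum (i : K) : Continuous fun x : K × I × J → ℝ => invExpSum x i := by
  unfold invExpSum
  exact continuous_finsetSum _ fun a _ =>
    (continuous_expSum i a).inv₀ fun x => (expSum_pos x i a).ne'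

lemma sum_condWeight (x : K × I × J → ℝ) (i : K) (a : I) :
    ∑ u, condWeight (i, a, u) x = 1 := by
  simp only [condWeight, ← Finset.sum_div]
  exact div_self (expSum_pos x i a).ne'

lemma condWeight_nonneg (q : K × I × J) (x : K × I × J → ℝ) : 0 ≤ condWeight q x :=
  div_nonneg (Real.exp_pos _).le (expSum_pos _ _ _).le

lemma continuous_condWeight (q : K × I × J) : Continuous (condWeight q) :=
  Continuous.div (by fun_prop) (continuous_expSum _ _) fun x => (expSum_pos x _ _).ne'

variable [Nonempty I]

lemma continuous_softMinMax (p : ℝ) : Continuous (softMinMax (K := K) (I := I) (J := J) p) := by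
  unfold softMinMax
  exact Real.continuous_exp.comp (continuous_const.mul (continuous_finsetSum _ fun i _ =>
    (continuous_invExpSum i).log fun x => (invExpSum_pos x i).ne'))

lemma continuous_gibbsWeight (q : K × I × J) : Continuous (gibbsWeight q) := by
  unfold gibbsWeight
  refine Continuous.div (by fun_prop)
    (((continuous_expSum _ _).pow 2).mul (continuous_invExpSum _)) fun x => ?_
  exact (mul_pos (pow_pos (expSum_pos _ _ _) 2) (invExpSum_pos _ _)).ne'

lemma gibbsWeight_nonneg (q : K × I × J) (x : K × I × J → ℝ) : 0 ≤ gibbsWeight q x :=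
  div_nonneg (Real.exp_pos _).le
    (mul_pos (pow_pos (expSum_pos _ _ _) 2) (invExpSum_pos _ _)).le

lemma sum_gibbsWeight (x : K × I × J → ℝ) (i : K) :
    ∑ s : I × J, gibbsWeight (i, s) x = 1 := by
  rw [Fintype.sum_prod_type]
  have h : ∀ a, ∑ u, gibbsWeight (i, a, u) x = (expSum x i a)⁻¹ / invExpSum x i := by
    intro a
    have h1 := (expSum_pos x i a).ne'
    have h2 := (invExpSum_pos x i).ne'
    simp only [gibbsWeight, ← Finset.sum_div]
    change expSum x i a / _ = _
    field_simp
  simp only [h, ← Finset.sum_div]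
  exact div_self (invExpSum_pos x i).ne'

lemma gibbsWeight_le_one (q : K × I × J) (x : K × I × J → ℝ) : gibbsWeight q x ≤ 1 := by
  rw [← sum_gibbsWeight x q.1]
  exact Finset.single_le_sum (f := fun s => gibbsWeight (q.1, s) x)
    (fun s _ => gibbsWeight_nonneg _ _) (Finset.mem_univ q.2)

lemma condWeight_le_one (q : K × I × J) (x : K × I × J → ℝ) : condWeight q x ≤ 1 := by
  rw [← sum_condWeight x q.1 q.2.1]
  exact Finset.single_le_sum (f := fun u => condWeight (q.1, q.2.1, u) x)
    (fun s _ => condWeight_nonneg _ _) (Finset.mem_univ q.2.2)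

lemma hasDerivAt_expSum {W : ℝ → K × I × J → ℝ} {W' : K × I × J → ℝ} {t : ℝ}
    (hW : ∀ q, HasDerivAt (fun s => W s q) (W' q) t) (i : K) (a : I) :
    HasDerivAt (fun s => expSum (W s) i a)
      (expSum (W t) i a * ∑ u, condWeight (i, a, u) (W t) * W' (i, a, u)) t := by
  have h := HasDerivAt.fun_sum (u := Finset.univ)
    (fun u (_ : u ∈ Finset.univ) => (hW (i, a, u)).exp)
  refine h.congr_deriv ?_
  rw [Finset.mul_sum]
  refine Finset.sum_congr rfl fun u _ => ?_
  have h1 := (expSum_pos (W t) i a).ne'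
  simp only [condWeight]
  field_simp

lemma hasDerivAt_invExpSum {W : ℝ → K × I × J → ℝ} {W' : K × I × J → ℝ} {t : ℝ}
    (hW : ∀ q, HasDerivAt (fun s => W s q) (W' q) t) (i : K) :
    HasDerivAt (fun s => invExpSum (W s) i)
      (-(invExpSum (W t) i * ∑ s : I × J, gibbsWeight (i, s) (W t) * W' (i, s))) t := by
  have h := HasDerivAt.fun_sum (u := Finset.univ)
    (fun a (_ : a ∈ Finset.univ) => (hasDerivAt_expSum hW i a).fun_inv (expSum_pos (W t) i a).ne')
  refine h.congr_deriv ?_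
  rw [Fintype.sum_prod_type, Finset.mul_sum, ← Finset.sum_neg_distrib]
  refine Finset.sum_congr rfl fun a _ => ?_
  rw [neg_div, neg_inj, Finset.mul_sum, Finset.mul_sum, Finset.sum_div]
  refine Finset.sum_congr rfl fun u _ => ?_
  have h1 := (expSum_pos (W t) i a).ne'
  have h2 := (invExpSum_pos (W t) i).ne'
  simp only [condWeight, gibbsWeight]
  field_simp

lemma hasDerivAt_softMinMax (p : ℝ) {W : ℝ → K × I × J → ℝ} {W' : K × I × J → ℝ} {t : ℝ}
    (hW : ∀ q, HasDerivAt (fun s => W s q) (W' q) t) :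
    HasDerivAt (fun s => softMinMax p (W s))
      (-p * softMinMax p (W t) * ∑ q, gibbsWeight q (W t) * W' q) t := by
  have h := ((HasDerivAt.fun_sum (u := Finset.univ) (fun i (_ : i ∈ Finset.univ) =>
    (hasDerivAt_invExpSum hW i).log (invExpSum_pos (W t) i).ne')).const_mul p).exp
  refine h.congr_deriv ?_
  rw [Fintype.sum_prod_type]
  have : ∀ i, -(invExpSum (W t) i * ∑ s : I × J, gibbsWeight (i, s) (W t) * W' (i, s))
      / invExpSum (W t) i = -∑ s : I × J, gibbsWeight (i, s) (W t) * W' (i, s) := by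
    intro i
    have h2 := (invExpSum_pos (W t) i).ne'
    field_simp
  simp only [this, Finset.sum_neg_distrib]
  simp only [softMinMax]
  ring

lemma hasDerivAt_gibbsWeight {W : ℝ → K × I × J → ℝ} {W' : K × I × J → ℝ} {t : ℝ}
    (hW : ∀ q, HasDerivAt (fun s => W s q) (W' q) t) (q : K × I × J) :
    HasDerivAt (fun s => gibbsWeight q (W s))
      (gibbsWeight q (W t) * (W' q
        - 2 * ∑ u, condWeight (q.1, q.2.1, u) (W t) * W' (q.1, q.2.1, u)
        + ∑ s : I × J, gibbsWeight (q.1, s) (W t) * W' (q.1, s))) t := by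
  have h1 := (expSum_pos (W t) q.1 q.2.1).ne'
  have h2 := (invExpSum_pos (W t) q.1).ne'
  have h := (hW q).exp.fun_div
    (((hasDerivAt_expSum hW q.1 q.2.1).fun_pow 2).fun_mul (hasDerivAt_invExpSum hW q.1))
    (mul_ne_zero (pow_ne_zero 2 h1) h2)
  refine h.congr_deriv ?_
  simp only [gibbsWeight]
  generalize ∑ u, condWeight (q.1, q.2.1, u) (W t) * W' (q.1, q.2.1, u) = a1
  generalize (∑ s : I × J, Real.exp (W t (q.1, s)) /
    (expSum (W t) (q.1, s).1 (q.1, s).2.1 ^ 2 * invExpSum (W t) (q.1, s).1) * W' (q.1, s)) = a2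
  field_simp
  push_cast
  ring

lemma hasGradient_softMinMax (p : ℝ) :
    HasGradient (softMinMax (K := K) (I := I) (J := J) p) (softGrad p) := by
  intro W W' t hW
  refine (hasDerivAt_softMinMax p hW).congr_deriv ?_
  rw [Finset.mul_sum]
  exact Finset.sum_congr rfl fun q _ => by rw [softGrad]; ring

open Classical in
/-- Contraction of a row of the bracket in `softHess` with a vector. -/
lemma sum_softHess_mul (p : ℝ) (q : K × I × J) (x y : K × I × J → ℝ) :
    ∑ r, softHess p q r x * y r = -p * softMinMax p x * gibbsWeight q x *
      (-p * ∑ r, gibbsWeight r x * y r + (y q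
        - 2 * ∑ u, condWeight (q.1, q.2.1, u) x * y (q.1, q.2.1, u)
        + ∑ s : I × J, gibbsWeight (q.1, s) x * y (q.1, s))) := by
  have e1 : ∑ r, (if q = r then (1 : ℝ) else 0) * y r = y q := by simp
  have e2 : ∑ r : K × I × J, (if q.1 = r.1 then gibbsWeight r x else 0) * y r
      = ∑ s : I × J, gibbsWeight (q.1, s) x * y (q.1, s) := by
    rw [Fintype.sum_prod_type, Finset.sum_eq_single q.1]
    · simp
    · intro b _ hb
      simp [hb.symm]
    · simp
  have e3 : ∑ r : K × I × J, (if q.1 = r.1 then if q.2.1 = r.2.1 then condWeight r x else 0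
      else 0) * y r = ∑ u, condWeight (q.1, q.2.1, u) x * y (q.1, q.2.1, u) := by
    rw [Fintype.sum_prod_type, Finset.sum_eq_single q.1]
    · rw [Fintype.sum_prod_type, Finset.sum_eq_single q.2.1]
      · simp
      · intro b _ hb
        simp [hb.symm]
      · simp
    · intro b _ hb
      simp [hb.symm]
    · simp
  rw [← e1, ← e2, ← e3]
  simp only [Finset.mul_sum, ← Finset.sum_add_distrib, ← Finset.sum_sub_distrib, softHess]
  refine Finset.sum_congr rfl fun r _ => ?_
  ring

lemma hasGradient_softGrad (p : ℝ) (q : K × I × J) :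
    HasGradient (softGrad p q) (softHess p q) := by
  intro W W' t hW
  have h := ((hasDerivAt_softMinMax p hW).const_mul (-p)).fun_mul (hasDerivAt_gibbsWeight hW q)
  refine h.congr_deriv ?_
  rw [sum_softHess_mul]
  ring

lemma continuous_softGrad (p : ℝ) (q : K × I × J) : Continuous (softGrad p q) :=
  (continuous_const.mul (continuous_softMinMax p)).mul (continuous_gibbsWeight q)

lemma continuous_softHess (p : ℝ) (q r : K × I × J) : Continuous (softHess p q r) := by
  unfold softHess
  refine ((continuous_const.mul (continuous_softMinMax p)).mul (continuous_gibbsWeight q)).mul ?_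
  refine Continuous.add (Continuous.sub (Continuous.add
    (continuous_const.mul (continuous_gibbsWeight r)) continuous_const)
    (continuous_const.mul ?_)) ?_
  · split_ifs
    exacts [continuous_condWeight r, continuous_const, continuous_const]
  · split_ifs
    exacts [continuous_gibbsWeight r, continuous_const]

/-- If the covariance difference `G` equals `-b` on pairs sharing `(i, a)`, is at least `-b` within
a replica, and at most `b` (resp. `3 b`) across (resp. within) replicas, then its contraction with
the Hessian is at most `p² b (k² + 2 k)` times the function, `k` being the number of replicas. -/
lemma sum_mul_softHess_le {p b : ℝ} (hp : 0 ≤ p)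
    (G : K × I × J → K × I × J → ℝ)
    (G1 : ∀ i a u u', G (i, a, u) (i, a, u') = -b)
    (G2 : ∀ i s s', -b ≤ G (i, s) (i, s')) (G3 : ∀ i s s', G (i, s) (i, s') ≤ 3 * b)
    (G4 : ∀ q r, q.1 ≠ r.1 → G q r ≤ b) (x : K × I × J → ℝ) :
    ∑ q, ∑ r, G q r * softHess p q r x
      ≤ p ^ 2 * b * (Fintype.card K ^ 2 + 2 * Fintype.card K) * softMinMax p x := by
  classical
  have hf := (softMinMax_pos p x).le
  have row : ∀ q, ∑ r, G q r * softHess p q r x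
      ≤ p ^ 2 * softMinMax p x * (gibbsWeight q x * ∑ r, gibbsWeight r x * G q r) := by
    intro q
    have e : ∑ r, G q r * softHess p q r x = ∑ r, softHess p q r x * G q r :=
      Finset.sum_congr rfl fun r _ => mul_comm _ _
    rw [e, sum_softHess_mul]
    have h1 : G q q = -b := G1 q.1 q.2.1 q.2.2 q.2.2
    have h2 : ∑ u, condWeight (q.1, q.2.1, u) x * G q (q.1, q.2.1, u) = -b := by
      have : ∀ u, G q (q.1, q.2.1, u) = -b := fun u => G1 q.1 q.2.1 q.2.2 u
      simp only [this, ← Finset.sum_mul, sum_condWeight, one_mul]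
    have h3 : -b ≤ ∑ s : I × J, gibbsWeight (q.1, s) x * G q (q.1, s) := by
      calc -b = ∑ s : I × J, gibbsWeight (q.1, s) x * (-b) := by
            rw [← Finset.sum_mul, sum_gibbsWeight, one_mul]
        _ ≤ _ := Finset.sum_le_sum fun s _ =>
            mul_le_mul_of_nonneg_left (G2 q.1 q.2 s) (gibbsWeight_nonneg _ _)
    rw [h1, h2]
    have h4 : 0 ≤ p * softMinMax p x * gibbsWeight q x *
        (-b - 2 * -b + ∑ s : I × J, gibbsWeight (q.1, s) x * G q (q.1, s)) :=
      mul_nonneg (mul_nonneg (mul_nonneg hp hf) (gibbsWeight_nonneg _ _)) (by linarith)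
    nlinarith [h4]
  have tot : ∑ q, gibbsWeight q x * ∑ r, gibbsWeight r x * G q r
      ≤ b * (Fintype.card K ^ 2 + 2 * Fintype.card K) := by
    have hr : ∀ q : K × I × J, ∑ r, gibbsWeight r x * G q r ≤ b * (Fintype.card K + 2) := by
      intro q
      have hs : ∀ i, ∑ s : I × J, gibbsWeight (i, s) x * G q (i, s)
          ≤ b * (1 + if i = q.1 then 2 else 0) := by
        intro i
        calc ∑ s : I × J, gibbsWeight (i, s) x * G q (i, s)
            ≤ ∑ s : I × J, gibbsWeight (i, s) x * (b * (1 + if i = q.1 then 2 else 0)) := by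
              refine Finset.sum_le_sum fun s _ =>
                mul_le_mul_of_nonneg_left ?_ (gibbsWeight_nonneg _ _)
              split_ifs with h
              · subst h
                linarith [G3 q.1 q.2 s]
              · linarith [G4 q (i, s) (Ne.symm h)]
          _ = _ := by rw [← Finset.sum_mul, sum_gibbsWeight, one_mul]
      rw [Fintype.sum_prod_type]
      refine (Finset.sum_le_sum fun i _ => hs i).trans (le_of_eq ?_)
      rw [← Finset.mul_sum, Finset.sum_add_distrib]
      simp
    calc ∑ q, gibbsWeight q x * ∑ r, gibbsWeight r x * G q r
        ≤ ∑ q : K × I × J, gibbsWeight q x * (b * (Fintype.card K + 2)) :=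
          Finset.sum_le_sum fun q _ => mul_le_mul_of_nonneg_left (hr q) (gibbsWeight_nonneg _ _)
      _ = _ := by
          rw [← Finset.sum_mul, Fintype.sum_prod_type]
          simp only [sum_gibbsWeight]
          simp
          ring
  calc ∑ q, ∑ r, G q r * softHess p q r x
      ≤ ∑ q, p ^ 2 * softMinMax p x * (gibbsWeight q x * ∑ r, gibbsWeight r x * G q r) :=
        Finset.sum_le_sum fun q _ => row q
    _ = p ^ 2 * softMinMax p x * ∑ q, gibbsWeight q x * ∑ r, gibbsWeight r x * G q r := by
        rw [Finset.mul_sum]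
    _ ≤ p ^ 2 * softMinMax p x * (b * (Fintype.card K ^ 2 + 2 * Fintype.card K)) := by gcongr
    _ = _ := by ring

end SoftMinMax

section SoftMinMaxBounds

set_option linter.unusedSectionVars false

variable {K I J : Type*} [Fintype K] [Fintype I] [Fintype J] [Nonempty I] [Nonempty J]

/-- The minimum over `a` of the maximum over `u` of a finite family. -/
noncomputable def minMax (x : I → J → ℝ) : ℝ := ⨅ a, ⨆ u, x a u

lemma continuous_minMax {X : Type*} [TopologicalSpace X] {x : X → I → J → ℝ}
    (hx : ∀ a u, Continuous fun z => x z a u) : Continuous fun z => minMax (x z) := by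
  simp only [minMax, ← Finset.inf'_univ_eq_ciInf, ← Finset.sup'_univ_eq_ciSup]
  exact Continuous.finset_inf'_apply _ fun a _ =>
    Continuous.finset_sup'_apply _ fun u _ => hx a u

lemma minMax_le {x : I → J → ℝ} {c : ℝ} (a : I) (h : ∀ u, x a u ≤ c) : minMax x ≤ c :=
  (ciInf_le (Set.finite_range _).bddBelow a).trans (ciSup_le h)

lemma abs_minMax_le {x : I → J → ℝ} {c : ℝ} (h : ∀ a u, |x a u| ≤ c) : |minMax x| ≤ c := by
  have a0 := Classical.arbitrary I
  have u0 := Classical.arbitrary J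
  refine abs_le.2 ⟨le_ciInf fun a => ?_, minMax_le a0 fun u => (abs_le.1 (h a0 u)).2⟩
  exact (abs_le.1 (h a u0)).1.trans (le_ciSup (f := fun u => x a u)
    (Set.finite_range _).bddAbove u0)

lemma minMax_const_mul {c : ℝ} (hc : 0 ≤ c) (x : I → J → ℝ) :
    minMax (fun a u => c * x a u) = c * minMax x := by
  simp only [minMax, Real.mul_iSup_of_nonneg hc, Real.mul_iInf_of_nonneg hc]

lemma log_invExpSum_le (x : K × I × J → ℝ) (i : K) :
    Real.log (invExpSum x i) ≤ Real.log (Fintype.card I) - minMax fun a u => x (i, a, u) := by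
  have hI : (0 : ℝ) < Fintype.card I := by exact_mod_cast Fintype.card_pos
  rw [Real.log_le_iff_le_exp (invExpSum_pos x i), Real.exp_sub, Real.exp_log hI, div_eq_mul_inv,
    ← Real.exp_neg]
  have : ∀ a, (expSum x i a)⁻¹ ≤ Real.exp (-minMax fun a u => x (i, a, u)) := by
    intro a
    rw [Real.exp_neg]
    refine inv_anti₀ (Real.exp_pos _) ?_
    obtain ⟨u, hu⟩ := exists_eq_ciSup_of_finite (f := fun u => x (i, a, u))
    calc Real.exp (minMax fun a u => x (i, a, u)) ≤ Real.exp (x (i, a, u)) := by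
          rw [hu]
          exact Real.exp_le_exp.2 (ciInf_le (Set.finite_range _).bddBelow a)
      _ ≤ _ := Finset.single_le_sum (f := fun u => Real.exp (x (i, a, u)))
          (fun _ _ => (Real.exp_pos _).le) (Finset.mem_univ u)
  refine (Finset.sum_le_sum fun a _ => this a).trans (le_of_eq ?_)
  simp

lemma le_log_invExpSum (x : K × I × J → ℝ) (i : K) :
    -(minMax fun a u => x (i, a, u)) - Real.log (Fintype.card J)
      ≤ Real.log (invExpSum x i) := by
  have hJ : (0 : ℝ) < Fintype.card J := by exact_mod_cast Fintype.card_pos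
  rw [Real.le_log_iff_exp_le (invExpSum_pos x i), Real.exp_sub, Real.exp_log hJ, Real.exp_neg,
    div_eq_mul_inv, ← mul_inv]
  obtain ⟨a, ha⟩ := exists_eq_ciInf_of_finite (f := fun a => ⨆ u, x (i, a, u))
  have h1 : expSum x i a ≤ Real.exp (minMax fun a u => x (i, a, u)) * Fintype.card J := by
    calc expSum x i a ≤ ∑ _u : J, Real.exp (minMax fun a u => x (i, a, u)) := by
          refine Finset.sum_le_sum fun u _ => Real.exp_le_exp.2 ?_
          rw [minMax, ← ha]
          exact le_ciSup (f := fun u => x (i, a, u)) (Set.finite_range _).bddAbove u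
      _ = _ := by simp [mul_comm]
  exact (inv_anti₀ (expSum_pos x i a) h1).trans (Finset.single_le_sum
    (f := fun a => (expSum x i a)⁻¹) (fun _ _ => (inv_pos.2 (expSum_pos _ _ _)).le)
    (Finset.mem_univ a))

lemma softMinMax_le {p : ℝ} (hp : 0 ≤ p) (x : K × I × J → ℝ) :
    softMinMax p x ≤ Real.exp (p * Fintype.card K * Real.log (Fintype.card I)) *
      ∏ i, Real.exp (-p * minMax fun a u => x (i, a, u)) := by
  rw [← Real.exp_sum, ← Real.exp_add, softMinMax, Real.exp_le_exp]
  calc p * ∑ i, Real.log (invExpSum x i)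
      ≤ p * ∑ i, (Real.log (Fintype.card I) - minMax fun a u => x (i, a, u)) := by
        gcongr with i
        exact log_invExpSum_le x i
    _ = _ := by
        rw [Finset.sum_sub_distrib, ← Finset.mul_sum]
        simp
        ring

lemma le_softMinMax {p : ℝ} (hp : 0 ≤ p) (x : K × I × J → ℝ) :
    Real.exp (-(p * Fintype.card K * Real.log (Fintype.card J))) *
      ∏ i, Real.exp (-p * minMax fun a u => x (i, a, u)) ≤ softMinMax p x := by
  rw [← Real.exp_sum, ← Real.exp_add, softMinMax, Real.exp_le_exp]
  calc _ = p * ∑ i, (-(minMax fun a u => x (i, a, u)) - Real.log (Fintype.card J)) := by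
        rw [Finset.sum_sub_distrib, ← Finset.mul_sum]
        simp
        ring
    _ ≤ _ := by
        gcongr with i
        exact le_log_invExpSum x i

lemma softMinMax_le_exp_sum_abs {p : ℝ} (hp : 0 ≤ p) (x : K × I × J → ℝ) :
    softMinMax p x ≤ Real.exp (p * Fintype.card K * Real.log (Fintype.card I)) *
      Real.exp (p * Fintype.card K * ∑ q, |x q|) := by
  refine (softMinMax_le hp x).trans ?_
  gcongr
  rw [← Real.exp_sum, Real.exp_le_exp]
  have h : ∀ i, -p * (minMax fun a u => x (i, a, u)) ≤ p * ∑ q, |x q| := by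
    intro i
    rw [neg_mul, ← mul_neg]
    gcongr
    exact (neg_le_abs _).trans (abs_minMax_le fun a u => Finset.single_le_sum
      (f := fun q => |x q|) (fun _ _ => abs_nonneg _) (Finset.mem_univ (i, a, u)))
  refine (Finset.sum_le_sum fun i _ => h i).trans (le_of_eq ?_)
  simp
  ring

lemma abs_softGrad_le {p : ℝ} (hp : 0 ≤ p) (q : K × I × J) (x : K × I × J → ℝ) :
    |softGrad p q x| ≤ p * softMinMax p x := by
  have h1 := gibbsWeight_nonneg q x
  have h2 := gibbsWeight_le_one q x
  have h3 := mul_nonneg hp (softMinMax_pos p x).le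
  rw [softGrad, neg_mul, neg_mul, abs_neg, abs_of_nonneg (mul_nonneg h3 h1)]
  exact mul_le_of_le_one_right h3 h2

lemma abs_softHess_le {p : ℝ} (hp : 0 ≤ p) (q r : K × I × J) (x : K × I × J → ℝ) :
    |softHess p q r x| ≤ p * (p + 4) * softMinMax p x := by
  have h := abs_softGrad_le hp q x
  have e : softHess p q r x = softGrad p q x * _ := rfl
  rw [e, abs_mul]
  have g0 := gibbsWeight_nonneg r x
  have g1 := gibbsWeight_le_one r x
  have c0 := condWeight_nonneg r x
  have c1 := condWeight_le_one r x
  calc _ ≤ (p * softMinMax p x) * (p + 4) := by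
        refine mul_le_mul h ?_ (abs_nonneg _) (mul_nonneg hp (softMinMax_pos p x).le)
        have : 0 ≤ p * gibbsWeight r x := mul_nonneg hp g0
        have : p * gibbsWeight r x ≤ p := mul_le_of_le_one_right hp g1
        rw [abs_le]
        split_ifs <;> constructor <;> linarith
    _ = _ := by ring

end SoftMinMaxBounds

/-! ### Gordon's comparison for exponential moments -/

section Gordon

set_option linter.unusedSectionVars false

variable {R C : Type*} [Fintype R] [Fintype C]

section Marginals

variable {κ κ' K : Type*} [Fintype κ] [Fintype κ'] [Fintype K]

lemma measurePreserving_inl : MeasurePreserving (fun (z : κ ⊕ κ' → ℝ) s => z (Sum.inl s))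
    (gaussianPi (κ ⊕ κ')) (gaussianPi κ) :=
  measurePreserving_fst.comp
    (measurePreserving_sumPiEquivProdPi (fun _ : κ ⊕ κ' => gaussianReal 0 1))

lemma measurePreserving_inr : MeasurePreserving (fun (z : κ ⊕ κ' → ℝ) s => z (Sum.inr s))
    (gaussianPi (κ ⊕ κ')) (gaussianPi κ') :=
  measurePreserving_snd.comp
    (measurePreserving_sumPiEquivProdPi (fun _ : κ ⊕ κ' => gaussianReal 0 1))

lemma measurePreserving_curry : MeasurePreserving (fun (z : K × κ → ℝ) i s => z (i, s))
    (gaussianPi (K × κ)) (Measure.pi fun _ : K => gaussianPi κ) := by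
  refine ⟨by fun_prop, ?_⟩
  have h := Measure.infinitePi_map_curry (fun (_ : K) (_ : κ) => gaussianReal 0 1)
  simp only [Measure.infinitePi_eq_pi] at h
  exact h

end Marginals

lemma dotProduct_le_one {a b : C → ℝ} (ha : a ⬝ᵥ a = 1) (hb : b ⬝ᵥ b = 1) : a ⬝ᵥ b ≤ 1 := by
  have h : 0 ≤ (a - b) ⬝ᵥ (a - b) := Finset.sum_nonneg fun _ _ => mul_self_nonneg _
  rw [sub_dotProduct, dotProduct_sub, dotProduct_sub, ha, hb, dotProduct_comm b a] at h
  linarith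

lemma neg_one_le_dotProduct {a b : C → ℝ} (ha : a ⬝ᵥ a = 1) (hb : b ⬝ᵥ b = 1) :
    -1 ≤ a ⬝ᵥ b := by
  have h := dotProduct_le_one (a := a) (b := -b) ha (by simpa using hb)
  rw [dotProduct_neg] at h
  linarith

variable {I J : Type*}

/-- The Gaussian process `⟨Φ a, u⟩`. -/
noncomputable def bilinProc (a : I → C → ℝ) (u : J → R → ℝ) (z : R × C → ℝ) (i : I) (j : J) : ℝ :=
  ∑ s, z s * (u j s.1 * a i s.2)

/-- The Gaussian process `⟨g, a⟩ + ⟨h, u⟩`. -/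
noncomputable def sepProc (a : I → C → ℝ) (u : J → R → ℝ) (w : C ⊕ R → ℝ) (i : I) (j : J) : ℝ :=
  (∑ s, w (Sum.inl s) * a i s) + ∑ s, w (Sum.inr s) * u j s

variable [Fintype I] [Fintype J] [Nonempty I] [Nonempty J]

/-- The comparison at the level of the smooth surrogate, with `K` the set of replicas. -/
lemma integral_softMinMax_bilinProc_le (K : Type*) [Fintype K]
    {a : I → C → ℝ} {u : J → R → ℝ} (ha : ∀ i, a i ⬝ᵥ a i = 1) (hu : ∀ j, u j ⬝ᵥ u j = 1)
    {p β : ℝ} (hp : 0 ≤ p) :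
    ∫ z, softMinMax (K := K) p (fun q => β * bilinProc a u z q.2.1 q.2.2) ∂(gaussianPi (R × C))
      ≤ Real.exp (p ^ 2 * β ^ 2 * (Fintype.card K ^ 2 + 2 * Fintype.card K) / 2) *
        ∫ w, softMinMax p (fun q : K × I × J => β * sepProc a u (w q.1) q.2.1 q.2.2)
          ∂(Measure.pi fun _ : K => gaussianPi (C ⊕ R)) := by
  classical
  obtain ⟨A, A1, A2⟩ : ∃ A : Matrix (K × I × J) ((R × C) ⊕ (K × (C ⊕ R))) ℝ,
      (∀ q s, A q (Sum.inl s) = β * (u q.2.2 s.1 * a q.2.1 s.2)) ∧ ∀ q s, A q (Sum.inr s) = 0 :=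
    ⟨Matrix.of fun q => Sum.elim (fun s => β * (u q.2.2 s.1 * a q.2.1 s.2)) (fun _ => 0),
      fun _ _ => rfl, fun _ _ => rfl⟩
  obtain ⟨B, B1, B2⟩ : ∃ B : Matrix (K × I × J) ((R × C) ⊕ (K × (C ⊕ R))) ℝ,
      (∀ q s, B q (Sum.inl s) = 0) ∧
      ∀ q s, B q (Sum.inr s) = if q.1 = s.1 then β * Sum.elim (a q.2.1) (u q.2.2) s.2 else 0 :=
    ⟨Matrix.of fun q => Sum.elim (fun _ => 0)
      (fun s => if q.1 = s.1 then β * Sum.elim (a q.2.1) (u q.2.2) s.2 else 0),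
      fun _ _ => rfl, fun _ _ => rfl⟩
  have hA : ∀ z, A.mulVec z
      = fun q => β * bilinProc a u (fun s => z (Sum.inl s)) q.2.1 q.2.2 := by
    intro z
    ext q
    simp only [Matrix.mulVec, dotProduct, A1, A2, Fintype.sum_sum_type,
      zero_mul, Finset.sum_const_zero, add_zero, bilinProc, Finset.mul_sum]
    exact Finset.sum_congr rfl fun s _ => by ring
  have hB : ∀ z, B.mulVec z
      = fun q => β * sepProc a u (fun s => z (Sum.inr (q.1, s))) q.2.1 q.2.2 := by
    intro z
    ext q
    simp only [Matrix.mulVec, dotProduct, B1, B2, Fintype.sum_sum_type,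
      zero_mul, Finset.sum_const_zero, zero_add, sepProc]
    rw [Fintype.sum_prod_type, Finset.sum_eq_single q.1]
    · simp only [if_true, Fintype.sum_sum_type, Sum.elim_inl, Sum.elim_inr, mul_add,
        Finset.mul_sum]
      congr 1 <;> exact Finset.sum_congr rfl fun s _ => by ring
    · intro b _ hb
      simp [hb.symm]
    · simp
  have hAB : A * B.transpose = 0 := by
    ext q r
    simp [Matrix.mul_apply, A1, A2, B1, B2, Fintype.sum_sum_type]
  have hAA : ∀ q r, (A * A.transpose) q r
      = β ^ 2 * ((a q.2.1 ⬝ᵥ a r.2.1) * (u q.2.2 ⬝ᵥ u r.2.2)) := by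
    intro q r
    simp only [Matrix.mul_apply, A1, A2, Matrix.transpose_apply, Fintype.sum_sum_type,
      zero_mul, Finset.sum_const_zero, add_zero, dotProduct]
    rw [Fintype.sum_prod_type, mul_comm (∑ i, a q.2.1 i * a r.2.1 i), Finset.sum_mul_sum,
      Finset.mul_sum]
    refine Finset.sum_congr rfl fun s _ => ?_
    rw [Finset.mul_sum]
    exact Finset.sum_congr rfl fun t _ => by ring
  have hBB : ∀ q r, (B * B.transpose) q r
      = if q.1 = r.1 then β ^ 2 * ((a q.2.1 ⬝ᵥ a r.2.1) + (u q.2.2 ⬝ᵥ u r.2.2)) else 0 := by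
    intro q r
    simp only [Matrix.mul_apply, B1, B2, Matrix.transpose_apply, Fintype.sum_sum_type,
      zero_mul, Finset.sum_const_zero, zero_add, dotProduct]
    rw [Fintype.sum_prod_type, Finset.sum_eq_single q.1]
    · by_cases h : q.1 = r.1
      · simp only [h, if_true, Fintype.sum_sum_type, Sum.elim_inl, Sum.elim_inr, mul_add,
          Finset.mul_sum]
        congr 1 <;> exact Finset.sum_congr rfl fun s _ => by ring
      · simp [h, Ne.symm h]
    · intro b _ hb
      simp [hb.symm]
    · simp
  have key := integral_mulVec_le_of_hessian_le A B hAB (hasGradient_softMinMax p)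
    (fun q => hasGradient_softGrad p q) (continuous_softMinMax p)
    (fun q => continuous_softGrad p q) (fun q r => continuous_softHess p q r)
    (C := (1 + p + p * (p + 4)) * Real.exp (p * Fintype.card K * Real.log (Fintype.card I)))
    (c := p * Fintype.card K) (by positivity)
    (fun x => by
      rw [abs_of_pos (softMinMax_pos p x), mul_assoc]
      refine (softMinMax_le_exp_sum_abs hp x).trans (le_mul_of_one_le_left (by positivity) ?_)
      nlinarith)
    (fun q x => by
      rw [mul_assoc]
      refine (abs_softGrad_le hp q x).trans ?_
      refine mul_le_mul ?_ (softMinMax_le_exp_sum_abs hp x) (softMinMax_pos p x).le (by positivity)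
      nlinarith)
    (fun q r x => by
      rw [mul_assoc]
      refine (abs_softHess_le hp q r x).trans ?_
      refine mul_le_mul ?_ (softMinMax_le_exp_sum_abs hp x) (softMinMax_pos p x).le (by positivity)
      nlinarith)
    (a := p ^ 2 * β ^ 2 * (Fintype.card K ^ 2 + 2 * Fintype.card K))
    (fun x => by
      refine sum_mul_softHess_le hp (b := β ^ 2)
        (fun q r => (A * A.transpose - B * B.transpose) q r) ?_ ?_ ?_ ?_ x
      · intro i c d d'
        simp only [Matrix.sub_apply, hAA, hBB, ha, if_true]
        ring
      · intro i s s'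
        simp only [Matrix.sub_apply, hAA, hBB, if_true]
        have h1 := dotProduct_le_one (ha s.1) (ha s'.1)
        have h2 := dotProduct_le_one (hu s.2) (hu s'.2)
        nlinarith [mul_nonneg (sq_nonneg β) (mul_nonneg (sub_nonneg.2 h1) (sub_nonneg.2 h2))]
      · intro i s s'
        simp only [Matrix.sub_apply, hAA, hBB, if_true]
        have h1 := dotProduct_le_one (ha s.1) (ha s'.1)
        have h2 := dotProduct_le_one (hu s.2) (hu s'.2)
        have h3 := neg_one_le_dotProduct (ha s.1) (ha s'.1)
        have h4 := neg_one_le_dotProduct (hu s.2) (hu s'.2)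
        rw [← mul_sub, mul_comm 3]
        refine mul_le_mul_of_nonneg_left ?_ (sq_nonneg β)
        nlinarith
      · intro q r hqr
        simp only [Matrix.sub_apply, hAA, hBB, if_neg hqr, sub_zero]
        have h1 := dotProduct_le_one (ha q.2.1) (ha r.2.1)
        have h2 := dotProduct_le_one (hu q.2.2) (hu r.2.2)
        have h3 := neg_one_le_dotProduct (ha q.2.1) (ha r.2.1)
        have h4 := neg_one_le_dotProduct (hu q.2.2) (hu r.2.2)
        refine mul_le_of_le_one_right (sq_nonneg β) ?_
        nlinarith)
  simp only [hA, hB] at key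
  have cX : Continuous fun z : R × C → ℝ =>
      softMinMax (K := K) p (fun q => β * bilinProc a u z q.2.1 q.2.2) :=
    (continuous_softMinMax p).comp (by unfold bilinProc; fun_prop)
  have cY : Continuous fun w : K → (C ⊕ R → ℝ) =>
      softMinMax p (fun q : K × I × J => β * sepProc a u (w q.1) q.2.1 q.2.2) :=
    (continuous_softMinMax p).comp (by unfold sepProc; fun_prop)
  have mX := measurePreserving_inl (κ := R × C) (κ' := K × (C ⊕ R))
  have mY := (measurePreserving_curry (κ := C ⊕ R) (K := K)).comp
    (measurePreserving_inr (κ := R × C) (κ' := K × (C ⊕ R)))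
  rw [← mX.map_eq, ← mY.map_eq, integral_map mX.aemeasurable cX.aestronglyMeasurable,
    integral_map mY.aemeasurable cY.aestronglyMeasurable]
  exact key

lemma abs_le_one_of_dotProduct {a : C → ℝ} (ha : a ⬝ᵥ a = 1) (s : C) : |a s| ≤ 1 := by
  have h : a s * a s ≤ 1 := by
    rw [← ha]
    exact Finset.single_le_sum (f := fun s => a s * a s) (fun _ _ => mul_self_nonneg _)
      (Finset.mem_univ s)
  exact abs_le_one_iff_mul_self_le_one.2 h

lemma abs_sepProc_le {a : I → C → ℝ} {u : J → R → ℝ} (ha : ∀ i, a i ⬝ᵥ a i = 1)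
    (hu : ∀ j, u j ⬝ᵥ u j = 1) (w : C ⊕ R → ℝ) (i : I) (j : J) :
    |sepProc a u w i j| ≤ ∑ s, |w s| := by
  rw [sepProc, Fintype.sum_sum_type]
  refine (abs_add_le _ _).trans (add_le_add ?_ ?_) <;>
  refine (Finset.abs_sum_le_sum_abs _ _).trans (Finset.sum_le_sum fun s _ => ?_) <;>
  rw [abs_mul]
  · exact mul_le_of_le_one_right (abs_nonneg _) (abs_le_one_of_dotProduct (ha i) s)
  · exact mul_le_of_le_one_right (abs_nonneg _) (abs_le_one_of_dotProduct (hu j) s)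

lemma abs_bilinProc_le {a : I → C → ℝ} {u : J → R → ℝ} (ha : ∀ i, a i ⬝ᵥ a i = 1)
    (hu : ∀ j, u j ⬝ᵥ u j = 1) (z : R × C → ℝ) (i : I) (j : J) :
    |bilinProc a u z i j| ≤ ∑ s, |z s| := by
  refine (Finset.abs_sum_le_sum_abs _ _).trans (Finset.sum_le_sum fun s _ => ?_)
  rw [abs_mul, abs_mul]
  exact mul_le_of_le_one_right (abs_nonneg _) (mul_le_one₀
    (abs_le_one_of_dotProduct (hu j) _) (abs_nonneg _) (abs_le_one_of_dotProduct (ha i) _))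

/-- Second-order upper bound for the exponential, valid on the whole line. -/
lemma exp_le_one_add_add_sq_mul (y : ℝ) :
    Real.exp y ≤ 1 + y + y ^ 2 * Real.exp |y| := by
  have h1 : Real.exp y - 1 ≤ y * Real.exp y := by
    have := Real.add_one_le_exp (-y)
    have h2 : Real.exp (-y) * Real.exp y = 1 := by rw [← Real.exp_add]; simp
    nlinarith [Real.exp_pos y]
  rcases le_total 0 y with hy | hy
  · rw [abs_of_nonneg hy]
    nlinarith
  · have h3 := Real.add_one_le_exp y
    have h4 : 1 ≤ Real.exp |y| := Real.one_le_exp (abs_nonneg y)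
    nlinarith [sq_nonneg y]

/-- A Laplace transform is governed by the mean near the origin. -/
lemma integral_exp_neg_le {Ω : Type*} [MeasurableSpace Ω] {μ : Measure Ω} [IsProbabilityMeasure μ]
    {M : Ω → ℝ} {lam s : ℝ} (hs : 0 ≤ s) (hsl : s ≤ lam) (hM : Integrable M μ)
    (hQ : Integrable (fun w => M w ^ 2 * Real.exp (lam * |M w|)) μ)
    (hE : Integrable (fun w => Real.exp (-s * M w)) μ) :
    ∫ w, Real.exp (-s * M w) ∂μ
      ≤ Real.exp (-s * ∫ w, M w ∂μ + s ^ 2 * ∫ w, M w ^ 2 * Real.exp (lam * |M w|) ∂μ) := by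
  calc ∫ w, Real.exp (-s * M w) ∂μ
      ≤ ∫ w, (1 + -s * M w) + s ^ 2 * (M w ^ 2 * Real.exp (lam * |M w|)) ∂μ := by
        refine integral_mono hE (((integrable_const _).add (hM.const_mul _)).add
          (hQ.const_mul _)) fun w => ?_
        refine (exp_le_one_add_add_sq_mul _).trans ?_
        rw [abs_mul, abs_neg, abs_of_nonneg hs, mul_pow, neg_sq, ← mul_assoc]
        gcongr
    _ = 1 + (-s * ∫ w, M w ∂μ + s ^ 2 * ∫ w, M w ^ 2 * Real.exp (lam * |M w|) ∂μ) := by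
        have i1 : Integrable (fun w => 1 + -s * M w) μ := (integrable_const _).add (hM.const_mul _)
        rw [integral_add i1 (hQ.const_mul _),
          integral_add (integrable_const _) (hM.const_mul _), integral_const_mul,
          integral_const_mul]
        simp
        ring
    _ ≤ _ := by
        rw [add_comm]
        exact Real.add_one_le_exp _

/-- Gordon's comparison for exponential moments: the minimum over `a` of the maximum over `u` of
`⟨Φ a, u⟩` has a lower tail that is subgaussian, with variance proxy one, around the corresponding
mean for the process `⟨g, a⟩ + ⟨h, u⟩`. -/
theorem integral_exp_neg_minMax_bilinProc_le
    {a : I → C → ℝ} {u : J → R → ℝ} (ha : ∀ i, a i ⬝ᵥ a i = 1) (hu : ∀ j, u j ⬝ᵥ u j = 1)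
    {lam : ℝ} (hlam : 0 ≤ lam) :
    ∫ z, Real.exp (-lam * minMax (bilinProc a u z)) ∂(gaussianPi (R × C))
      ≤ Real.exp (lam ^ 2 / 2 - lam * ∫ w, minMax (sepProc a u w) ∂(gaussianPi (C ⊕ R))) := by
  set m := ∫ w, minMax (sepProc a u w) ∂(gaussianPi (C ⊕ R)) with hm
  set Q := ∫ w, minMax (sepProc a u w) ^ 2 * Real.exp (lam * |minMax (sepProc a u w)|)
    ∂(gaussianPi (C ⊕ R)) with hQ
  set lI := Real.log (Fintype.card I)
  set lJ := Real.log (Fintype.card J)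
  have cM : Continuous fun w => minMax (sepProc a u w) :=
    continuous_minMax fun i j => by unfold sepProc; fun_prop
  have cB : Continuous fun z => minMax (bilinProc a u z) :=
    continuous_minMax fun i j => by unfold bilinProc; fun_prop
  have bM : ∀ w, |minMax (sepProc a u w)| ≤ ∑ s, |w s| := fun w =>
    abs_minMax_le fun i j => abs_sepProc_le ha hu w i j
  have bB : ∀ z, |minMax (bilinProc a u z)| ≤ ∑ s, |z s| := fun z =>
    abs_minMax_le fun i j => abs_bilinProc_le ha hu z i j
  have iM : Integrable (fun w => minMax (sepProc a u w)) (gaussianPi (C ⊕ R)) := by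
    refine integrable_of_abs_le_exp (C := 1) (c := 1) cM fun w => ?_
    rw [one_mul, one_mul]
    linarith [bM w, Real.add_one_le_exp (∑ s, |w s|)]
  have iQ : Integrable (fun w => minMax (sepProc a u w) ^ 2 *
      Real.exp (lam * |minMax (sepProc a u w)|)) (gaussianPi (C ⊕ R)) := by
    refine integrable_of_abs_le_exp (C := 1) (c := 2 + lam) (by fun_prop) fun w => ?_
    have h0 := abs_nonneg (minMax (sepProc a u w))
    have h1 : |minMax (sepProc a u w)| ≤ Real.exp (∑ s, |w s|) := by
      linarith [bM w, Real.add_one_le_exp (∑ s, |w s|)]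
    rw [one_mul, abs_mul, abs_pow, Real.abs_exp, add_mul, Real.exp_add, two_mul, Real.exp_add,
      ← sq]
    gcongr
    exact bM w
  have iE : ∀ s : ℝ, 0 ≤ s → Integrable (fun w => Real.exp (-s * minMax (sepProc a u w)))
      (gaussianPi (C ⊕ R)) := by
    intro s hs
    refine integrable_of_abs_le_exp (C := 1) (c := s) (by fun_prop) fun w => ?_
    rw [one_mul, Real.abs_exp, Real.exp_le_exp, neg_mul, ← mul_neg]
    exact mul_le_mul_of_nonneg_left ((neg_le_abs _).trans (bM w)) hs
  -- The estimate with `k + 1` replicas, inverse temperature `k + 1` and exponent `lam / (k + 1)²`.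
  have step : ∀ k : ℕ, ∫ z, Real.exp (-lam * minMax (bilinProc a u z)) ∂(gaussianPi (R × C))
      ≤ Real.exp (lam ^ 2 / 2 - lam * m
        + (lam ^ 2 + lam * lI + lam * lJ + lam ^ 2 * Q) * (1 / ((k : ℝ) + 1))) := by
    intro k
    set n : ℝ := (k : ℝ) + 1 with hn
    have n0 : 0 < n := by positivity
    set p : ℝ := lam / n ^ 2 with hp
    have p0 : 0 ≤ p := by positivity
    set s : ℝ := lam / n with hs
    have s0 : 0 ≤ s := by positivity
    have sl : s ≤ lam := div_le_self hlam (by rw [hn]; linarith [(Nat.cast_nonneg k : (0:ℝ) ≤ k)])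
    have hps : p * n = s := by rw [hp, hs]; field_simp
    have hcard : (Fintype.card (Fin (k + 1)) : ℝ) = n := by simp [hn]
    have key := integral_softMinMax_bilinProc_le (Fin (k + 1)) ha hu (β := n) p0
    rw [hcard] at key
    have low : Real.exp (-(s * lJ)) *
        ∫ z, Real.exp (-lam * minMax (bilinProc a u z)) ∂(gaussianPi (R × C))
        ≤ ∫ z, softMinMax (K := Fin (k + 1)) p (fun q => n * bilinProc a u z q.2.1 q.2.2)
          ∂(gaussianPi (R × C)) := by
      rw [← integral_const_mul]
      refine integral_mono_of_nonneg (Filter.Eventually.of_forall fun z => by positivity) ?_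
        (Filter.Eventually.of_forall fun z => ?_)
      · refine integrable_of_abs_le_exp
          (C := Real.exp (p * n * lI)) (c := lam)
          ((continuous_softMinMax p).comp (by unfold bilinProc; fun_prop)) fun z => ?_
        rw [abs_of_pos (softMinMax_pos _ _)]
        refine (softMinMax_le p0 _).trans ?_
        rw [hcard]
        gcongr
        simp only [minMax_const_mul n0.le (fun i j => bilinProc a u z i j)]
        rw [Finset.prod_const, ← Real.exp_nat_mul, Real.exp_le_exp, Finset.card_univ, hcard]
        have : n * (-p * (n * minMax (bilinProc a u z))) = lam * (-minMax (bilinProc a u z)) := by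
          rw [hp]; field_simp
        rw [this]
        exact mul_le_mul_of_nonneg_left ((neg_le_abs _).trans (bB z)) hlam
      · refine le_trans (le_of_eq ?_) (le_softMinMax p0 _)
        simp only [minMax_const_mul n0.le (fun i j => bilinProc a u z i j)]
        rw [Finset.prod_const, ← Real.exp_nat_mul, Finset.card_univ, hcard, hps]
        congr 2
        rw [hp]
        field_simp
    have high : ∫ w, softMinMax p
          (fun q : Fin (k + 1) × I × J => n * sepProc a u (w q.1) q.2.1 q.2.2)
          ∂(Measure.pi fun _ : Fin (k + 1) => gaussianPi (C ⊕ R))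
        ≤ Real.exp (s * lI) *
          (∫ w, Real.exp (-s * minMax (sepProc a u w)) ∂(gaussianPi (C ⊕ R))) ^ (k + 1) := by
      have e := integral_fintype_prod_eq_pow (ι := Fin (k + 1)) (μ := gaussianPi (C ⊕ R))
        (fun w => Real.exp (-s * minMax (sepProc a u w)))
      rw [Fintype.card_fin] at e
      rw [← e, ← integral_const_mul]
      refine integral_mono_of_nonneg (Filter.Eventually.of_forall fun w =>
        (softMinMax_pos _ _).le) ?_ (Filter.Eventually.of_forall fun w => ?_)
      · exact (Integrable.fintype_prod (fun _ => iE s s0)).const_mul _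
      · refine (softMinMax_le p0 _).trans (le_of_eq ?_)
        rw [hcard, hps]
        congr 1
        refine Finset.prod_congr rfl fun i _ => ?_
        simp only [minMax_const_mul n0.le (fun c d => sepProc a u (w i) c d)]
        rw [← mul_assoc, neg_mul p, hps]
    have lap := integral_exp_neg_le s0 sl iM iQ (iE s s0)
    have tot : Real.exp (-(s * lJ)) *
        ∫ z, Real.exp (-lam * minMax (bilinProc a u z)) ∂(gaussianPi (R × C))
        ≤ Real.exp (p ^ 2 * n ^ 2 * (n ^ 2 + 2 * n) / 2) * (Real.exp (s * lI) *
          Real.exp (-s * m + s ^ 2 * Q) ^ (k + 1)) := by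
      refine low.trans (key.trans ?_)
      gcongr
      refine high.trans ?_
      gcongr
    rw [← Real.exp_nat_mul, ← Real.exp_add, ← Real.exp_add] at tot
    have := mul_le_mul_of_nonneg_left tot (Real.exp_pos (s * lJ)).le
    rw [← mul_assoc, ← Real.exp_add, ← Real.exp_add] at this
    simp only [add_neg_cancel, Real.exp_zero, one_mul] at this
    refine this.trans (le_of_eq ?_)
    congr 1
    push_cast
    rw [← hn, hp, hs]
    field_simp
    ring
  have lim : Filter.Tendsto (fun k : ℕ => Real.exp (lam ^ 2 / 2 - lam * m
      + (lam ^ 2 + lam * lI + lam * lJ + lam ^ 2 * Q) * (1 / ((k : ℝ) + 1)))) Filter.atTop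
      (nhds (Real.exp (lam ^ 2 / 2 - lam * m))) := by
    have h := (tendsto_one_div_add_atTop_nhds_zero_nat (𝕜 := ℝ)).const_mul
      (lam ^ 2 + lam * lI + lam * lJ + lam ^ 2 * Q)
    have h2 := (Real.continuous_exp.tendsto _).comp (h.const_add (lam ^ 2 / 2 - lam * m))
    simpa [Function.comp_def] using h2
  exact ge_of_tendsto' lim step

end Gordon

/-! ### Gaussian widths of subsets of the unit sphere -/

section Width

variable {d : ℕ}

/-- The support function of `S`. -/
noncomputable def supInner (S : Set (EuclideanSpace ℝ (Fin d))) (g : EuclideanSpace ℝ (Fin d)) :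
    ℝ :=
  ⨆ x : S, inner ℝ g (x : EuclideanSpace ℝ (Fin d))

lemma gaussianWidth_eq (S : Set (EuclideanSpace ℝ (Fin d))) :
    gaussianWidth S = ∫ g, supInner S g ∂(stdGaussian (EuclideanSpace ℝ (Fin d))) := rfl

lemma supInner_empty (g : EuclideanSpace ℝ (Fin d)) : supInner ∅ g = 0 := by
  simp [supInner]

variable {S T : Set (EuclideanSpace ℝ (Fin d))}

lemma abs_inner_le_norm_of_sphere {x : EuclideanSpace ℝ (Fin d)} (hx : x ∈ Metric.sphere 0 1)
    (g : EuclideanSpace ℝ (Fin d)) : |inner ℝ g x| ≤ ‖g‖ := by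
  have := abs_real_inner_le_norm g x
  rwa [mem_sphere_zero_iff_norm.1 hx, mul_one] at this

lemma bddAbove_inner (hS : S ⊆ Metric.sphere 0 1) (g : EuclideanSpace ℝ (Fin d)) :
    BddAbove (Set.range fun x : S => inner ℝ g (x : EuclideanSpace ℝ (Fin d))) := by
  refine ⟨‖g‖, ?_⟩
  rintro _ ⟨x, rfl⟩
  exact (le_abs_self _).trans (abs_inner_le_norm_of_sphere (hS x.2) g)

lemma inner_le_supInner (hS : S ⊆ Metric.sphere 0 1) {x : EuclideanSpace ℝ (Fin d)} (hx : x ∈ S)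
    (g : EuclideanSpace ℝ (Fin d)) : inner ℝ g x ≤ supInner S g :=
  le_ciSup (bddAbove_inner hS g) ⟨x, hx⟩

lemma supInner_le (hne : S.Nonempty) {g : EuclideanSpace ℝ (Fin d)} {c : ℝ}
    (h : ∀ x ∈ S, inner ℝ g x ≤ c) : supInner S g ≤ c :=
  have : Nonempty S := hne.to_subtype
  ciSup_le fun x => h x x.2

lemma abs_supInner_le (hS : S ⊆ Metric.sphere 0 1) (g : EuclideanSpace ℝ (Fin d)) :
    |supInner S g| ≤ ‖g‖ := by
  rcases S.eq_empty_or_nonempty with rfl | hne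
  · simp [supInner_empty]
  · obtain ⟨x, hx⟩ := hne
    refine abs_le.2 ⟨?_, supInner_le ⟨x, hx⟩ fun y hy =>
      (le_abs_self _).trans (abs_inner_le_norm_of_sphere (hS hy) g)⟩
    exact (abs_le.1 (abs_inner_le_norm_of_sphere (hS hx) g)).1.trans (inner_le_supInner hS hx g)

lemma supInner_le_add (hS : S ⊆ Metric.sphere 0 1) (g h : EuclideanSpace ℝ (Fin d)) :
    supInner S g ≤ supInner S h + ‖g - h‖ := by
  rcases S.eq_empty_or_nonempty with rfl | hne
  · simp [supInner_empty]
  · refine supInner_le hne fun x hx => ?_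
    have h1 := (le_abs_self _).trans (abs_inner_le_norm_of_sphere (hS hx) (g - h))
    rw [inner_sub_left] at h1
    linarith [inner_le_supInner hS hx h]

lemma continuous_supInner (hS : S ⊆ Metric.sphere 0 1) : Continuous (supInner S) := by
  refine (LipschitzWith.of_le_add_mul 1 fun g h => ?_).continuous
  rw [NNReal.coe_one, one_mul, dist_eq_norm]
  exact supInner_le_add hS g h

lemma integrable_norm_stdGaussian :
    Integrable (fun g => ‖g‖) (stdGaussian (EuclideanSpace ℝ (Fin d))) :=
  (IsGaussian.integrable_id (μ := stdGaussian (EuclideanSpace ℝ (Fin d)))).norm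

lemma integrable_norm_sq_stdGaussian :
    Integrable (fun g => ‖g‖ ^ 2) (stdGaussian (EuclideanSpace ℝ (Fin d))) :=
  (IsGaussian.memLp_two_id (μ := stdGaussian (EuclideanSpace ℝ (Fin d)))).integrable_norm_pow
    two_ne_zero

lemma integrable_supInner (hS : S ⊆ Metric.sphere 0 1) :
    Integrable (supInner S) (stdGaussian (EuclideanSpace ℝ (Fin d))) :=
  integrable_norm_stdGaussian.mono' (continuous_supInner hS).aestronglyMeasurable
    (Filter.Eventually.of_forall fun g => abs_supInner_le hS g)

lemma integrable_supInner_sq (hS : S ⊆ Metric.sphere 0 1) :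
    Integrable (fun g => supInner S g ^ 2) (stdGaussian (EuclideanSpace ℝ (Fin d))) := by
  refine integrable_norm_sq_stdGaussian.mono' ((continuous_supInner hS).pow 2).aestronglyMeasurable
    (Filter.Eventually.of_forall fun g => ?_)
  rw [Real.norm_eq_abs, abs_pow]
  gcongr
  exact abs_supInner_le hS g

lemma supInner_mono (hST : S ⊆ T) (hT : T ⊆ Metric.sphere 0 1) (hne : S.Nonempty)
    (g : EuclideanSpace ℝ (Fin d)) : supInner S g ≤ supInner T g :=
  supInner_le hne fun _ hx => inner_le_supInner hT (hST hx) g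

lemma gaussianWidth_mono (hST : S ⊆ T) (hT : T ⊆ Metric.sphere 0 1) (hne : S.Nonempty) :
    gaussianWidth S ≤ gaussianWidth T :=
  integral_mono (integrable_supInner (hST.trans hT)) (integrable_supInner hT)
    (supInner_mono hST hT hne)

lemma integral_inner_stdGaussian (x : EuclideanSpace ℝ (Fin d)) :
    ∫ g, inner ℝ g x ∂(stdGaussian (EuclideanSpace ℝ (Fin d))) = 0 := by
  have := integral_strongDual_stdGaussian (innerSL ℝ x)
  simpa [real_inner_comm] using this

lemma integral_inner_sq_stdGaussian (x : EuclideanSpace ℝ (Fin d)) :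
    ∫ g, inner ℝ g x ^ 2 ∂(stdGaussian (EuclideanSpace ℝ (Fin d))) = ‖x‖ ^ 2 := by
  have h := variance_dual_stdGaussian (innerSL ℝ x)
  rw [variance_of_integral_eq_zero (by fun_prop) (integral_strongDual_stdGaussian _)] at h
  simpa [real_inner_comm] using h

lemma integrable_inner_sq (x : EuclideanSpace ℝ (Fin d)) :
    Integrable (fun g => inner ℝ g x ^ 2) (stdGaussian (EuclideanSpace ℝ (Fin d))) := by
  refine (integrable_norm_sq_stdGaussian.mul_const (‖x‖ ^ 2)).mono' (by fun_prop)
    (Filter.Eventually.of_forall fun g => ?_)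
  rw [Real.norm_eq_abs, abs_pow, ← mul_pow]
  gcongr
  exact abs_real_inner_le_norm g x

lemma integral_norm_sq_stdGaussian :
    ∫ g, ‖g‖ ^ 2 ∂(stdGaussian (EuclideanSpace ℝ (Fin d))) = d := by
  have h : ∀ g : EuclideanSpace ℝ (Fin d),
      ‖g‖ ^ 2 = ∑ i, inner ℝ g (EuclideanSpace.basisFun (Fin d) ℝ i) ^ 2 := fun g =>
    ((EuclideanSpace.basisFun (Fin d) ℝ).sum_sq_inner_right g).symm.trans
      (by simp [real_inner_comm])
  simp_rw [h]
  rw [integral_finsetSum _ fun i _ => integrable_inner_sq _]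
  simp [integral_inner_sq_stdGaussian]

lemma gaussianWidth_nonneg (hS : S ⊆ Metric.sphere 0 1) : 0 ≤ gaussianWidth S := by
  rcases S.eq_empty_or_nonempty with rfl | ⟨x, hx⟩
  · simp [gaussianWidth_eq, supInner_empty]
  · rw [← integral_inner_stdGaussian x, gaussianWidth_eq]
    refine integral_mono ?_ (integrable_supInner hS) (fun g => inner_le_supInner hS hx g)
    exact integrable_norm_stdGaussian.mono' (by fun_prop)
      (Filter.Eventually.of_forall fun g => abs_inner_le_norm_of_sphere (hS hx) g)

lemma nonempty_of_gaussianWidth_pos (h : 0 < gaussianWidth S) : S.Nonempty := by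
  rw [Set.nonempty_iff_ne_empty]
  rintro rfl
  simp [gaussianWidth_eq, supInner_empty] at h

lemma map_neg_stdGaussian :
    (stdGaussian (EuclideanSpace ℝ (Fin d))).map (fun g => -g)
      = stdGaussian (EuclideanSpace ℝ (Fin d)) :=
  stdGaussian_map (LinearIsometryEquiv.neg ℝ (E := EuclideanSpace ℝ (Fin d)))

lemma integral_comp_neg_stdGaussian {f : EuclideanSpace ℝ (Fin d) → ℝ} (hf : Continuous f) :
    ∫ g, f (-g) ∂(stdGaussian (EuclideanSpace ℝ (Fin d)))
      = ∫ g, f g ∂(stdGaussian (EuclideanSpace ℝ (Fin d))) := by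
  conv_rhs => rw [← map_neg_stdGaussian,
    integral_map (by fun_prop) hf.aestronglyMeasurable]

lemma supInner_neg_set (g : EuclideanSpace ℝ (Fin d)) :
    supInner (Neg.neg ⁻¹' S) g = supInner S (-g) := by
  unfold supInner
  refine Equiv.iSup_congr
    ((Equiv.neg (EuclideanSpace ℝ (Fin d))).subtypeEquiv fun x => Iff.rfl) fun x => ?_
  change inner ℝ (-g) (-(x : EuclideanSpace ℝ (Fin d))) = _
  exact inner_neg_neg _ _

lemma gaussianWidth_neg (hS : S ⊆ Metric.sphere 0 1) :
    gaussianWidth (Neg.neg ⁻¹' S) = gaussianWidth S := by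
  simp_rw [gaussianWidth_eq, supInner_neg_set]
  exact integral_comp_neg_stdGaussian (continuous_supInner hS)

/-- Subsets of the sphere have finite nets. -/
lemma exists_finite_net (hS : S ⊆ Metric.sphere 0 1) {δ : ℝ} (hδ : 0 < δ) :
    ∃ J ⊆ S, J.Finite ∧ ∀ x ∈ S, ∃ y ∈ J, ‖x - y‖ ≤ δ := by
  have hb : TotallyBounded S :=
    ((isCompact_sphere (0 : EuclideanSpace ℝ (Fin d)) 1).totallyBounded).subset hS
  obtain ⟨J, hJS, hJ, hc⟩ := Metric.finite_approx_of_totallyBounded hb δ hδ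
  refine ⟨J, hJS, hJ, fun x hx => ?_⟩
  obtain ⟨y, hy, hxy⟩ := Set.mem_iUnion₂.1 (hc hx)
  exact ⟨y, hy, by rw [← dist_eq_norm]; exact (Metric.mem_ball.1 hxy).le⟩

lemma supInner_le_of_net {J : Set (EuclideanSpace ℝ (Fin d))} (hne : S.Nonempty)
    (hJ : J ⊆ Metric.sphere 0 1) {δ : ℝ} (hnet : ∀ x ∈ S, ∃ y ∈ J, ‖x - y‖ ≤ δ)
    (g : EuclideanSpace ℝ (Fin d)) : supInner S g ≤ supInner J g + δ * ‖g‖ := by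
  refine supInner_le hne fun x hx => ?_
  obtain ⟨y, hy, hxy⟩ := hnet x hx
  have h1 := inner_le_supInner hJ hy g
  have h2 := (le_abs_self _).trans (abs_real_inner_le_norm g (x - y))
  rw [inner_sub_right] at h2
  nlinarith [mul_le_mul_of_nonneg_left hxy (norm_nonneg g)]

lemma gaussianWidth_le_of_net {J : Set (EuclideanSpace ℝ (Fin d))} (hS : S ⊆ Metric.sphere 0 1)
    (hne : S.Nonempty)
    (hJ : J ⊆ Metric.sphere 0 1) {δ : ℝ} (hnet : ∀ x ∈ S, ∃ y ∈ J, ‖x - y‖ ≤ δ) :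
    gaussianWidth S ≤ gaussianWidth J
      + δ * ∫ g, ‖g‖ ∂(stdGaussian (EuclideanSpace ℝ (Fin d))) := by
  rw [gaussianWidth_eq, gaussianWidth_eq, ← integral_const_mul,
    ← integral_add (integrable_supInner hJ) (integrable_norm_stdGaussian.const_mul _)]
  exact integral_mono (integrable_supInner hS)
    ((integrable_supInner hJ).add (integrable_norm_stdGaussian.const_mul _))
    (supInner_le_of_net hne hJ hnet)

/-! ### Gordon's comparison in terms of widths -/

/-- The coordinates of the points of `S`. -/
def coords (S : Set (EuclideanSpace ℝ (Fin d))) (x : S) : Fin d → ℝ :=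
  (x : EuclideanSpace ℝ (Fin d)).ofLp

lemma inner_toLp (w : Fin d → ℝ) (x : EuclideanSpace ℝ (Fin d)) :
    inner ℝ (WithLp.toLp 2 w) x = ∑ i, w i * x.ofLp i := by
  simp [PiLp.inner_apply, mul_comm]

lemma coords_dotProduct (hS : S ⊆ Metric.sphere 0 1) (x : S) :
    coords S x ⬝ᵥ coords S x = 1 := by
  have h := mem_sphere_zero_iff_norm.1 (hS x.2)
  have h2 := EuclideanSpace.real_norm_sq_eq (x : EuclideanSpace ℝ (Fin d))
  rw [h] at h2
  simp only [coords, dotProduct, ← sq]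
  linarith

lemma measurePreserving_toLp : MeasurePreserving (WithLp.toLp 2) (gaussianPi (Fin d))
    (stdGaussian (EuclideanSpace ℝ (Fin d))) :=
  ⟨by fun_prop, map_pi_eq_stdGaussian⟩

lemma integral_comp_of_measurePreserving {X Y : Type*} [MeasurableSpace X] [MeasurableSpace Y]
    {μ : Measure X} {ν : Measure Y} {φ : X → Y} (hφ : MeasurePreserving φ μ ν) {f : Y → ℝ}
    (hf : AEStronglyMeasurable f ν) : ∫ x, f (φ x) ∂μ = ∫ y, f y ∂ν := by
  rw [← hφ.map_eq] at hf ⊢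
  exact (integral_map hφ.aemeasurable hf).symm

lemma iInf_inner (g : EuclideanSpace ℝ (Fin d)) :
    ⨅ x : S, inner ℝ g (x : EuclideanSpace ℝ (Fin d)) = -supInner S (-g) := by
  simp only [supInner, inner_neg_left]
  rw [iInf, Real.sInf_def, iSup]
  congr 2
  ext r
  simp [neg_eq_iff_eq_neg]

end Width

section GordonWidth

variable {m n : ℕ} {I : Set (EuclideanSpace ℝ (Fin n))} {J : Set (EuclideanSpace ℝ (Fin m))}

lemma minMax_sepProc (hJ : J.Finite) (hI : I.Finite) (hIne : I.Nonempty) (hJne : J.Nonempty)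
    (w : Fin n ⊕ Fin m → ℝ) :
    minMax (sepProc (coords I) (coords J) w)
      = -supInner I (-WithLp.toLp 2 fun s => w (Sum.inl s))
        + supInner J (WithLp.toLp 2 fun s => w (Sum.inr s)) := by
  have := hI.to_subtype
  have := hJ.to_subtype
  have := hIne.to_subtype
  have := hJne.to_subtype
  have h1 : ∀ i, ⨆ j, sepProc (coords I) (coords J) w i j
      = inner ℝ (WithLp.toLp 2 fun s => w (Sum.inl s)) (i : EuclideanSpace ℝ (Fin n))
        + supInner J (WithLp.toLp 2 fun s => w (Sum.inr s)) := by
    intro i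
    have h : ∀ j, sepProc (coords I) (coords J) w i j
      = inner ℝ (WithLp.toLp 2 fun s => w (Sum.inl s)) (i : EuclideanSpace ℝ (Fin n)) +
        inner ℝ (WithLp.toLp 2 fun s => w (Sum.inr s)) (j : EuclideanSpace ℝ (Fin m)) := by
      intro j
      rw [inner_toLp, inner_toLp]
      rfl
    simp only [h, supInner]
    exact ((OrderIso.addLeft _).map_ciSup (Set.finite_range _).bddAbove).symm
  simp only [minMax, h1]
  rw [← iInf_inner]
  exact ((OrderIso.addRight _).map_ciInf (Set.finite_range _).bddBelow).symm

lemma integral_minMax_sepProc (hI : I.Finite) (hJ : J.Finite) (hIne : I.Nonempty)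
    (hJne : J.Nonempty) (hIS : I ⊆ Metric.sphere 0 1) (hJS : J ⊆ Metric.sphere 0 1) :
    ∫ w, minMax (sepProc (coords I) (coords J) w) ∂(gaussianPi (Fin n ⊕ Fin m))
      = gaussianWidth J - gaussianWidth I := by
  simp only [minMax_sepProc hJ hI hIne hJne]
  have cI := (continuous_supInner hIS).comp (continuous_neg (G := EuclideanSpace ℝ (Fin n)))
  have cJ := continuous_supInner hJS
  have iI : Integrable (fun g => supInner I (-g)) (stdGaussian (EuclideanSpace ℝ (Fin n))) :=
    integrable_norm_stdGaussian.mono' cI.aestronglyMeasurable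
      (Filter.Eventually.of_forall fun g => by
        rw [← norm_neg g]
        exact abs_supInner_le hIS (-g))
  have mI := (measurePreserving_toLp (d := n)).comp
    (measurePreserving_inl (κ := Fin n) (κ' := Fin m))
  have mJ := (measurePreserving_toLp (d := m)).comp
    (measurePreserving_inr (κ := Fin n) (κ' := Fin m))
  have e1 := integral_comp_of_measurePreserving mI cI.aestronglyMeasurable
  have e2 := integral_comp_of_measurePreserving mJ cJ.aestronglyMeasurable
  have e3 := integral_comp_neg_stdGaussian (continuous_supInner hIS)
  rw [gaussianWidth_eq, gaussianWidth_eq, ← e2, ← e3, sub_eq_neg_add]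
  refine Eq.trans ?_ (congrArg (-· + _) e1)
  rw [← integral_neg]
  exact integral_add (mI.integrable_comp_of_integrable iI).neg
    (mJ.integrable_comp_of_integrable (integrable_supInner hJS))

/-- Gordon's comparison for finite subsets of the spheres. -/
theorem integral_exp_neg_minMax_le_width (hI : I.Finite) (hJ : J.Finite) (hIne : I.Nonempty)
    (hJne : J.Nonempty) (hIS : I ⊆ Metric.sphere 0 1) (hJS : J ⊆ Metric.sphere 0 1)
    {lam : ℝ} (hlam : 0 ≤ lam) :
    ∫ z, Real.exp (-lam * minMax (bilinProc (coords I) (coords J) z))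
        ∂(gaussianPi (Fin m × Fin n))
      ≤ Real.exp (lam ^ 2 / 2 - lam * (gaussianWidth J - gaussianWidth I)) := by
  have := hI.fintype
  have := hJ.fintype
  have := hIne.to_subtype
  have := hJne.to_subtype
  have h := integral_exp_neg_minMax_bilinProc_le (coords_dotProduct hIS) (coords_dotProduct hJS)
    hlam
  rwa [integral_minMax_sepProc hI hJ hIne hJne hIS hJS] at h

end GordonWidth

/-! ### Variance of the support function -/

lemma measurePreserving_comp_equiv {κ κ' : Type*} [Fintype κ] [Fintype κ'] (e : κ' ≃ κ) :
    MeasurePreserving (fun (z : κ → ℝ) s => z (e s)) (gaussianPi κ) (gaussianPi κ') :=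
  measurePreserving_arrowCongr' (fun _ => gaussianReal 0 1) (fun _ => gaussianReal 0 1) e.symm
    (MeasurableEquiv.refl ℝ) fun _ => MeasurePreserving.id _

section Variance

variable {d : ℕ} {J : Set (EuclideanSpace ℝ (Fin d))}

/-- The single point `1` of the unit sphere of `ℝ¹`; Gordon's comparison with one of the two sets
equal to it is a concentration inequality for the support function of the other. -/
noncomputable def unitPoint : EuclideanSpace ℝ (Fin 1) := WithLp.toLp 2 fun _ => 1

lemma unitPoint_subset_sphere : ({unitPoint} : Set (EuclideanSpace ℝ (Fin 1))) ⊆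
    Metric.sphere 0 1 := by
  rintro _ rfl
  rw [mem_sphere_zero_iff_norm, EuclideanSpace.norm_eq]
  simp [unitPoint]

lemma unitPoint_ofLp (i : Fin 1) : unitPoint.ofLp i = 1 := rfl

lemma gaussianWidth_singleton (x : EuclideanSpace ℝ (Fin d)) :
    gaussianWidth {x} = 0 := by
  rw [← integral_inner_stdGaussian x, gaussianWidth]
  congr 1
  ext g
  exact ciSup_unique (ι := ({x} : Set (EuclideanSpace ℝ (Fin d))))

lemma integral_exp_neg_mul_supInner_le (hJ : J.Finite) (hJne : J.Nonempty)
    (hJS : J ⊆ Metric.sphere 0 1) {lam : ℝ} (hlam : 0 ≤ lam) :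
    ∫ g, Real.exp (-lam * supInner J g) ∂(stdGaussian (EuclideanSpace ℝ (Fin d)))
      ≤ Real.exp (lam ^ 2 / 2 - lam * gaussianWidth J) := by
  have h := integral_exp_neg_minMax_le_width (Set.finite_singleton unitPoint) hJ
    (Set.singleton_nonempty _) hJne unitPoint_subset_sphere hJS hlam
  rw [gaussianWidth_singleton, sub_zero] at h
  refine le_trans (le_of_eq ?_) h
  have mp := measurePreserving_toLp.comp
    (measurePreserving_comp_equiv (Equiv.prodUnique (Fin d) (Fin 1)).symm)
  rw [← integral_comp_of_measurePreserving mp (f := fun g => Real.exp (-lam * supInner J g))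
    (by have := continuous_supInner hJS; fun_prop)]
  congr 1
  ext z
  congr 2
  unfold minMax
  rw [ciInf_unique, supInner]
  congr 1
  ext x
  rw [Function.comp_apply, inner_toLp, bilinProc, Fintype.sum_prod_type]
  refine Finset.sum_congr rfl fun i _ => ?_
  simp [coords, unitPoint_ofLp]

lemma integral_exp_mul_supInner_le (hJ : J.Finite) (hJne : J.Nonempty)
    (hJS : J ⊆ Metric.sphere 0 1) {lam : ℝ} (hlam : 0 ≤ lam) :
    ∫ g, Real.exp (lam * supInner J g) ∂(stdGaussian (EuclideanSpace ℝ (Fin d)))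
      ≤ Real.exp (lam ^ 2 / 2 + lam * gaussianWidth J) := by
  have h := integral_exp_neg_minMax_le_width hJ (Set.finite_singleton unitPoint)
    hJne (Set.singleton_nonempty _) hJS unitPoint_subset_sphere hlam
  rw [gaussianWidth_singleton, zero_sub, mul_neg, sub_neg_eq_add] at h
  refine le_trans (le_of_eq ?_) h
  have mp := measurePreserving_toLp.comp
    (measurePreserving_comp_equiv (Equiv.uniqueProd (Fin d) (Fin 1)).symm)
  have hc := continuous_supInner hJS
  rw [← integral_comp_neg_stdGaussian (f := fun g => Real.exp (lam * supInner J g)) (by fun_prop),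
    ← integral_comp_of_measurePreserving mp (f := fun g => Real.exp (lam * supInner J (-g)))
    (by fun_prop)]
  congr 1
  ext z
  congr 1
  rw [neg_mul, ← mul_neg]
  congr 1
  rw [eq_neg_iff_add_eq_zero, add_comm, ← sub_neg_eq_add, ← iInf_inner, sub_eq_zero]
  unfold minMax
  congr 1
  ext x
  rw [ciSup_unique, Function.comp_apply, inner_toLp, bilinProc, Fintype.sum_prod_type]
  simp [coords, unitPoint_ofLp]

lemma integrable_exp_mul_supInner (hJS : J ⊆ Metric.sphere 0 1) (lam : ℝ) :
    Integrable (fun g => Real.exp (lam * supInner J g))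
      (stdGaussian (EuclideanSpace ℝ (Fin d))) := by
  have hc := continuous_supInner hJS
  have : Integrable (fun w : Fin d → ℝ => Real.exp (lam * supInner J (WithLp.toLp 2 w)))
      (gaussianPi (Fin d)) := by
    refine integrable_of_abs_le_exp (C := 1) (c := |lam|) (by fun_prop) fun w => ?_
    rw [one_mul, Real.abs_exp, Real.exp_le_exp]
    refine (le_abs_self _).trans ?_
    rw [abs_mul]
    gcongr
    refine (abs_supInner_le hJS _).trans ?_
    rw [EuclideanSpace.norm_eq]
    refine Real.sqrt_le_iff.2 ⟨by positivity, ?_⟩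
    simpa using Finset.sum_sq_le_sq_sum_of_nonneg (s := Finset.univ) (f := fun i => |w i|)
      (fun _ _ => abs_nonneg _)
  rw [← measurePreserving_toLp.map_eq]
  exact (integrable_map_measure (by fun_prop) (by fun_prop)).2 this

lemma sq_le_exp_add_exp_neg (y : ℝ) : y ^ 2 ≤ Real.exp y + Real.exp (-y) - 2 := by
  have h : y ^ 2 / 4 ≤ Real.sinh (y / 2) ^ 2 := by
    have : (|y| / 2) ^ 2 ≤ (Real.sinh (|y| / 2)) ^ 2 :=
      pow_le_pow_left₀ (by positivity) (Real.self_le_sinh_iff.2 (by positivity)) 2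
    rcases abs_cases y with ⟨h, _⟩ | ⟨h, _⟩ <;> rw [h] at this
    · nlinarith
    · rw [neg_div, Real.sinh_neg] at this
      nlinarith
  rw [Real.sinh_eq] at h
  have e1 : Real.exp (y / 2) ^ 2 = Real.exp y := by
    rw [← Real.exp_nat_mul]; congr 1; push_cast; ring
  have e2 : Real.exp (-(y / 2)) ^ 2 = Real.exp (-y) := by
    rw [← Real.exp_nat_mul]; congr 1; push_cast; ring
  have e3 : Real.exp (y / 2) * Real.exp (-(y / 2)) = 1 := by rw [← Real.exp_add]; simp
  nlinarith

/-- The support function of a finite subset of the sphere has variance at most one. -/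
lemma integral_supInner_sq_le_of_finite (hJ : J.Finite) (hJne : J.Nonempty)
    (hJS : J ⊆ Metric.sphere 0 1) :
    ∫ g, supInner J g ^ 2 ∂(stdGaussian (EuclideanSpace ℝ (Fin d)))
      ≤ gaussianWidth J ^ 2 + 1 := by
  set μ := stdGaussian (EuclideanSpace ℝ (Fin d))
  set m := gaussianWidth J with hm
  have i1 := integrable_supInner hJS
  have i2 := integrable_supInner_sq hJS
  have iv : Integrable (fun g => (supInner J g - m) ^ 2) μ := by
    refine ((i2.sub (i1.const_mul (2 * m))).add (integrable_const (m ^ 2))).congr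
      (Filter.Eventually.of_forall fun g => ?_)
    simp only [Pi.add_apply, Pi.sub_apply]
    ring
  have hv : ∫ g, (supInner J g - m) ^ 2 ∂μ = (∫ g, supInner J g ^ 2 ∂μ) - m ^ 2 := by
    have e : ∀ g, (supInner J g - m) ^ 2 = supInner J g ^ 2 - (2 * m * supInner J g - m ^ 2) :=
      fun g => by ring
    simp_rw [e]
    have i3 : Integrable (fun g => 2 * m * supInner J g - m ^ 2) μ :=
      (i1.const_mul _).sub (integrable_const _)
    rw [integral_sub i2 i3, integral_sub (i1.const_mul _) (integrable_const _),
      integral_const_mul, ← gaussianWidth_eq, ← hm]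
    simp
    ring
  have hs : ∀ t : ℝ, 0 < t → t < 1 → (∫ g, (supInner J g - m) ^ 2 ∂μ) * (1 - t) ≤ 1 := by
    intro t t0 t1
    set lam := Real.sqrt (2 * t) with hl
    have l0 : 0 ≤ lam := Real.sqrt_nonneg _
    have l2 : lam ^ 2 = 2 * t := Real.sq_sqrt (by linarith)
    have a1 := integral_exp_mul_supInner_le hJ hJne hJS l0
    have a2 := integral_exp_neg_mul_supInner_le hJ hJne hJS l0
    have j1 := integrable_exp_mul_supInner hJS lam
    have j2 := integrable_exp_mul_supInner hJS (-lam)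
    have p1 : ∀ g, lam ^ 2 * (supInner J g - m) ^ 2 ≤ (Real.exp (-lam * m) *
        Real.exp (lam * supInner J g) + Real.exp (lam * m) * Real.exp (-lam * supInner J g))
        - 2 := by
      intro g
      have := sq_le_exp_add_exp_neg (lam * (supInner J g - m))
      rw [← Real.exp_add, ← Real.exp_add]
      convert! this using 1
      · ring
      · congr 3 <;> ring
    have i4 : Integrable (fun g => Real.exp (-lam * m) *
        Real.exp (lam * supInner J g) + Real.exp (lam * m) * Real.exp (-lam * supInner J g)) μ :=
      (j1.const_mul _).add (j2.const_mul _)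
    have p2 := integral_mono (iv.const_mul (lam ^ 2)) (i4.sub (integrable_const 2)) p1
    simp only [Pi.sub_apply] at p2
    rw [integral_sub i4 (integrable_const _), integral_add (j1.const_mul _) (j2.const_mul _),
      integral_const_mul, integral_const_mul, integral_const_mul] at p2
    simp only [integral_const, probReal_univ, smul_eq_mul, one_mul] at p2
    have q1 : Real.exp (-lam * m) * ∫ g, Real.exp (lam * supInner J g) ∂μ ≤ Real.exp t := by
      refine (mul_le_mul_of_nonneg_left a1 (Real.exp_pos _).le).trans (le_of_eq ?_)
      rw [← Real.exp_add, l2]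
      congr 1
      ring
    have q2 : Real.exp (lam * m) * ∫ g, Real.exp (-lam * supInner J g) ∂μ ≤ Real.exp t := by
      refine (mul_le_mul_of_nonneg_left a2 (Real.exp_pos _).le).trans (le_of_eq ?_)
      rw [← Real.exp_add, l2]
      congr 1
      ring
    rw [l2] at p2
    have r : Real.exp t * (1 - t) ≤ 1 := by
      have h1 := Real.add_one_le_exp (-t)
      have h2 : Real.exp t * Real.exp (-t) = 1 := by rw [← Real.exp_add]; simp
      nlinarith [Real.exp_pos t]
    have w : t * ∫ g, (supInner J g - m) ^ 2 ∂μ ≤ Real.exp t - 1 := by linarith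
    have w2 : t * ((∫ g, (supInner J g - m) ^ 2 ∂μ) * (1 - t)) ≤ t * 1 := by nlinarith
    exact le_of_mul_le_mul_left w2 t0
  have lim : Filter.Tendsto (fun t : ℝ => (∫ g, (supInner J g - m) ^ 2 ∂μ) * (1 - t))
      (nhdsWithin 0 (Set.Ioi 0)) (nhds ((∫ g, (supInner J g - m) ^ 2 ∂μ) * (1 - 0))) :=
    (Continuous.tendsto (by fun_prop) 0).mono_left nhdsWithin_le_nhds
  have := le_of_tendsto lim (by
    filter_upwards [Ioo_mem_nhdsGT (zero_lt_one (α := ℝ))] with t ht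
    exact hs t ht.1 ht.2)
  linarith

/-- The support function of a subset of the sphere has variance at most one. -/
lemma integral_supInner_sq_le {S : Set (EuclideanSpace ℝ (Fin d))} (hS : S ⊆ Metric.sphere 0 1) :
    ∫ g, supInner S g ^ 2 ∂(stdGaussian (EuclideanSpace ℝ (Fin d)))
      ≤ gaussianWidth S ^ 2 + 1 := by
  rcases S.eq_empty_or_nonempty with rfl | hne
  · simp only [supInner_empty]
    simp
    positivity
  set μ := stdGaussian (EuclideanSpace ℝ (Fin d))
  have hδ : ∀ δ : ℝ, 0 < δ →
      ∫ g, supInner S g ^ 2 ∂μ ≤ gaussianWidth S ^ 2 + 1 + (2 * δ + δ ^ 2) * d := by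
    intro δ δ0
    obtain ⟨J, hJS, hJ, hnet⟩ := exists_finite_net hS δ0
    have hJne : J.Nonempty := by
      obtain ⟨x, hx⟩ := hne
      obtain ⟨y, hy, _⟩ := hnet x hx
      exact ⟨y, hy⟩
    have hJs := hJS.trans hS
    have p : ∀ g, supInner S g ^ 2 ≤ supInner J g ^ 2 + (2 * δ + δ ^ 2) * ‖g‖ ^ 2 := by
      intro g
      have h1 := supInner_mono hJS hS hJne g
      have h2 := supInner_le_of_net hne hJs hnet g
      have h3 := abs_le.1 (abs_supInner_le hJs g)
      have h4 := norm_nonneg g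
      nlinarith [mul_nonneg δ0.le h4, mul_nonneg (sub_nonneg.2 h1) (sub_nonneg.2 h2),
        mul_nonneg (sub_nonneg.2 h1) (sub_nonneg.2 h3.2),
        mul_nonneg (mul_nonneg δ0.le h4) (sub_nonneg.2 h3.2)]
    have h1 := integral_mono (integrable_supInner_sq hS)
      ((integrable_supInner_sq hJs).add (integrable_norm_sq_stdGaussian.const_mul _)) p
    simp only [Pi.add_apply] at h1
    rw [integral_add (integrable_supInner_sq hJs) (integrable_norm_sq_stdGaussian.const_mul _),
      integral_const_mul, integral_norm_sq_stdGaussian] at h1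
    have h2 := integral_supInner_sq_le_of_finite hJ hJne hJs
    have h3 : gaussianWidth J ^ 2 ≤ gaussianWidth S ^ 2 :=
      pow_le_pow_left₀ (gaussianWidth_nonneg hJs) (gaussianWidth_mono hJS hS hJne) 2
    linarith
  have lim : Filter.Tendsto (fun δ : ℝ => gaussianWidth S ^ 2 + 1 + (2 * δ + δ ^ 2) * d)
      (nhdsWithin 0 (Set.Ioi 0)) (nhds (gaussianWidth S ^ 2 + 1 + (2 * 0 + 0 ^ 2) * d)) :=
    (Continuous.tendsto (by fun_prop) 0).mono_left nhdsWithin_le_nhds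
  have := ge_of_tendsto lim (by
    filter_upwards [self_mem_nhdsWithin] with δ hδ0
    exact hδ δ hδ0)
  simpa using this

end Variance

/-! ### Probability that a Gaussian matrix maps a point of `A` into the polar of `U` -/

section Escape

variable {m n : ℕ} {A : Set (EuclideanSpace ℝ (Fin n))} {U : Set (EuclideanSpace ℝ (Fin m))}

/-- If the width of `U` exceeds that of `A` by `ε`, it is exponentially unlikely that some `a ∈ A`
satisfies `⟨Φ a, u⟩ ≤ 0` for all `u ∈ U`. -/
theorem gaussianPi_exists_polar_le (hA : A ⊆ Metric.sphere 0 1) (hU : U ⊆ Metric.sphere 0 1)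
    {ε : ℝ} (hε : 0 < ε) (h : gaussianWidth A + ε ≤ gaussianWidth U) :
    (gaussianPi (Fin m × Fin n)).real
        {z | ∃ a ∈ A, ∀ u ∈ U, ∑ s, z s * (u.ofLp s.1 * a.ofLp s.2) ≤ 0}
      ≤ Real.exp (-ε ^ 2 / 2) := by
  set μ := gaussianPi (Fin m × Fin n)
  set B := {z : Fin m × Fin n → ℝ | ∃ a ∈ A, ∀ u ∈ U,
    ∑ s, z s * (u.ofLp s.1 * a.ofLp s.2) ≤ 0} with hB
  rcases A.eq_empty_or_nonempty with hAe | hAne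
  · have : B = ∅ := by
      rw [hB, hAe]
      simp
    rw [this, measureReal_empty]
    positivity
  have hUne : U.Nonempty :=
    nonempty_of_gaussianWidth_pos (by linarith [gaussianWidth_nonneg hA])
  set c := ∫ g, ‖g‖ ∂(stdGaussian (EuclideanSpace ℝ (Fin m)))
  set N : (Fin m × Fin n → ℝ) → ℝ := fun z => ∑ s, |z s| with hN
  have iN : Integrable N μ := by
    refine integrable_of_abs_le_exp (C := 1) (c := 1) (by fun_prop) fun z => ?_
    rw [one_mul, one_mul, abs_of_nonneg (by positivity)]
    linarith [Real.add_one_le_exp (∑ s, |z s|)]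
  have step : ∀ δ R : ℝ, 0 < δ → 0 < R →
      μ.real B ≤ (∫ z, N z ∂μ) / R + Real.exp (-ε ^ 2 / 2 + ε * (δ * R + δ * c)) := by
    intro δ R δ0 R0
    obtain ⟨I, hIA, hI, hInet⟩ := exists_finite_net hA δ0
    obtain ⟨J, hJU, hJ, hJnet⟩ := exists_finite_net hU δ0
    have hIne : I.Nonempty := by
      obtain ⟨x, hx⟩ := hAne
      obtain ⟨y, hy, _⟩ := hInet x hx
      exact ⟨y, hy⟩
    have hJne : J.Nonempty := by
      obtain ⟨x, hx⟩ := hUne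
      obtain ⟨y, hy, _⟩ := hJnet x hx
      exact ⟨y, hy⟩
    have hIS := hIA.trans hA
    have hJS := hJU.trans hU
    have wI := gaussianWidth_mono hIA hA hIne
    have wJ := gaussianWidth_le_of_net hU hUne hJS hJnet
    have main := integral_exp_neg_minMax_le_width hI hJ hIne hJne hIS hJS hε.le
    have := hI.fintype
    have := hJ.fintype
    have := hIne.to_subtype
    have := hJne.to_subtype
    set X : (Fin m × Fin n → ℝ) → ℝ := fun z => minMax (bilinProc (coords I) (coords J) z) with hX
    have sub : B ⊆ {z | R ≤ N z} ∪ {z | Real.exp (-ε * (δ * R)) ≤ Real.exp (-ε * X z)} := by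
      rintro z ⟨a, ha, hau⟩
      rcases le_or_gt R (N z) with hR | hR
      · exact Or.inl hR
      refine Or.inr ?_
      obtain ⟨y, hy, hay⟩ := hInet a ha
      have hx : X z ≤ δ * R := by
        refine minMax_le ⟨y, hy⟩ fun j => ?_
        have h1 := hau j (hJU j.2)
        have h2 : bilinProc (coords I) (coords J) z ⟨y, hy⟩ j
            = (∑ s, z s * ((j : EuclideanSpace ℝ (Fin m)).ofLp s.1 * a.ofLp s.2))
              + ∑ s, z s * ((j : EuclideanSpace ℝ (Fin m)).ofLp s.1 * (y - a).ofLp s.2) := by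
          rw [← Finset.sum_add_distrib]
          refine Finset.sum_congr rfl fun s _ => ?_
          simp only [coords, WithLp.ofLp_sub, Pi.sub_apply]
          ring
        have h3 : ∑ s, z s * ((j : EuclideanSpace ℝ (Fin m)).ofLp s.1 * (y - a).ofLp s.2)
            ≤ ∑ s, |z s| * δ := by
          refine Finset.sum_le_sum fun s _ => (le_abs_self _).trans ?_
          rw [abs_mul, abs_mul]
          gcongr
          have k1 := abs_le_one_of_dotProduct (coords_dotProduct hJS j) s.1
          have k2 : |(y - a).ofLp s.2| ≤ δ := by
            refine (PiLp.norm_apply_le (y - a) s.2).trans ?_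
            rwa [norm_sub_rev]
          calc _ ≤ 1 * δ := mul_le_mul k1 k2 (abs_nonneg _) zero_le_one
            _ = δ := one_mul δ
        rw [← Finset.sum_mul] at h3
        rw [h2]
        nlinarith [hR.le]
      refine Real.exp_le_exp.2 ?_
      nlinarith
    have cX : Continuous X := continuous_minMax fun i j => by unfold bilinProc; fun_prop
    have iX : Integrable (fun z => Real.exp (-ε * X z)) μ := by
      refine integrable_of_abs_le_exp (C := 1) (c := ε) (by fun_prop) fun z => ?_
      rw [one_mul, Real.abs_exp, Real.exp_le_exp, neg_mul, ← mul_neg]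
      exact mul_le_mul_of_nonneg_left ((neg_le_abs _).trans (abs_minMax_le fun i j =>
        abs_bilinProc_le (coords_dotProduct hIS) (coords_dotProduct hJS) z i j)) hε.le
    have m1 := mul_meas_ge_le_integral_of_nonneg (μ := μ) (f := N)
      (Filter.Eventually.of_forall fun z => by positivity) iN R
    have m2 := mul_meas_ge_le_integral_of_nonneg (μ := μ) (f := fun z => Real.exp (-ε * X z))
      (Filter.Eventually.of_forall fun z => (Real.exp_pos _).le) iX (Real.exp (-ε * (δ * R)))
    have n1 : μ.real {z | R ≤ N z} ≤ (∫ z, N z ∂μ) / R := by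
      rw [le_div_iff₀ R0, mul_comm]
      exact m1
    have n2 : μ.real {z | Real.exp (-ε * (δ * R)) ≤ Real.exp (-ε * X z)}
        ≤ Real.exp (-ε ^ 2 / 2 + ε * (δ * R + δ * c)) := by
      have := m2.trans main
      rw [← le_div_iff₀' (Real.exp_pos _), ← Real.exp_sub] at this
      refine this.trans (Real.exp_le_exp.2 ?_)
      have : gaussianWidth J - gaussianWidth I ≥ ε - δ * c := by linarith
      nlinarith
    calc μ.real B ≤ μ.real ({z | R ≤ N z} ∪
          {z | Real.exp (-ε * (δ * R)) ≤ Real.exp (-ε * X z)}) := measureReal_mono sub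
      _ ≤ _ := measureReal_union_le _ _
      _ ≤ _ := add_le_add n1 n2
  -- Let `R → ∞` with `δ = R⁻²`.
  have lim : Filter.Tendsto (fun k : ℕ => (∫ z, N z ∂μ) * (1 / ((k : ℝ) + 1)) +
      Real.exp (-ε ^ 2 / 2 + ε * (1 / ((k : ℝ) + 1) + (1 / ((k : ℝ) + 1)) ^ 2 * c)))
      Filter.atTop (nhds ((∫ z, N z ∂μ) * 0 + Real.exp (-ε ^ 2 / 2 + ε * (0 + 0 ^ 2 * c)))) := by
    have h0 := tendsto_one_div_add_atTop_nhds_zero_nat (𝕜 := ℝ)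
    have hc : Continuous fun t : ℝ => (∫ z, N z ∂μ) * t +
      Real.exp (-ε ^ 2 / 2 + ε * (t + t ^ 2 * c)) := by fun_prop
    exact (hc.tendsto 0).comp h0
  have := ge_of_tendsto' lim fun k => by
    have k0 : (0 : ℝ) < (k : ℝ) + 1 := by positivity
    refine (step ((1 / ((k : ℝ) + 1)) ^ 2) ((k : ℝ) + 1) (by positivity) k0).trans (le_of_eq ?_)
    congr 2
    · ring
    · congr 2
      field_simp
  simpa using this

end Escape

/-! ### Convex cones and their polars -/

section Cones

variable {E : Type*} [NormedAddCommGroup E] [InnerProductSpace ℝ E]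

/-- The polar of a set: the vectors making a nonacute angle with all its elements. -/
def polarCone (K : Set E) : Set E := {u | ∀ k ∈ K, inner ℝ k u ≤ 0}

/-- Moreau's decomposition along a closed convex cone and its polar. -/
lemma exists_moreau [CompleteSpace E] (K : ConvexCone ℝ E) (h0 : (0 : E) ∈ K)
    (hK : IsClosed (K : Set E)) (h : E) :
    ∃ p ∈ K, h - p ∈ polarCone (K : Set E) ∧ inner ℝ (h - p) p = 0 := by
  obtain ⟨p, hp, hmin⟩ := exists_norm_eq_iInf_of_complete_convex ⟨0, h0⟩ hK.isComplete K.convex h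
  rw [norm_eq_iInf_iff_real_inner_le_zero K.convex hp] at hmin
  have h1 : inner ℝ (h - p) p ≤ 0 := by
    have := hmin (p + p) (K.add_mem hp hp)
    rwa [add_sub_cancel_right] at this
  have h2 : 0 ≤ inner ℝ (h - p) p := by
    have := hmin 0 h0
    rw [zero_sub, inner_neg_right] at this
    linarith
  refine ⟨p, hp, fun k hk => ?_, le_antisymm h1 h2⟩
  have := hmin (k + p) (K.add_mem hk hp)
  rwa [add_sub_cancel_right, real_inner_comm] at this

/-- A convex cone in a finite-dimensional space that is not contained in a half-space is the whole
space. No closedness is needed. -/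
lemma eq_univ_of_polarCone [FiniteDimensional ℝ E] (D : ConvexCone ℝ E) (h0 : (0 : E) ∈ D)
    (h : ∀ u ∈ polarCone (D : Set E), u = 0) : (D : Set E) = Set.univ := by
  have hcl : closure (D : Set E) = Set.univ := by
    refine Set.eq_univ_of_forall fun z => ?_
    obtain ⟨p, hp, hq, -⟩ := exists_moreau D.closure (subset_closure h0) isClosed_closure z
    have := h (z - p) fun k hk => hq k (subset_closure hk)
    rw [sub_eq_zero] at this
    rw [this]
    exact hp
  have hint : (interior (D : Set E)).Nonempty := by
    rw [D.convex.interior_nonempty_iff_affineSpan_eq_top]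
    have hc : IsClosed (affineSpan ℝ (D : Set E) : Set E) :=
      AffineSubspace.closed_of_finiteDimensional _
    have h1 := closure_minimal (subset_affineSpan ℝ (D : Set E)) hc
    rw [hcl] at h1
    exact SetLike.coe_injective (Set.univ_subset_iff.1 h1)
  obtain ⟨x, hx⟩ := hint
  refine Set.eq_univ_of_forall fun y => interior_subset ?_
  have h2 := D.convex.combo_interior_closure_mem_interior hx
    (hcl ▸ Set.mem_univ ((2 : ℝ) • y - x)) (a := 1 / 2) (b := 1 / 2) (by norm_num) (by norm_num)
    (by norm_num)
  convert! h2 using 1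
  module

end Cones

section ConeWidth

variable {d : ℕ}

lemma cone_inter_sphere_subset (S : Set (EuclideanSpace ℝ (Fin d))) :
    S ∩ Metric.sphere 0 1 ⊆ Metric.sphere 0 1 := Set.inter_subset_right

lemma inv_norm_smul_mem_sphere {x : EuclideanSpace ℝ (Fin d)} (hx : x ≠ 0) :
    ‖x‖⁻¹ • x ∈ Metric.sphere (0 : EuclideanSpace ℝ (Fin d)) 1 := by
  rw [mem_sphere_zero_iff_norm, norm_smul, norm_inv, norm_norm,
    inv_mul_cancel₀ (norm_ne_zero_iff.2 hx)]

lemma polarCone_smul {S : Set (EuclideanSpace ℝ (Fin d))} {u : EuclideanSpace ℝ (Fin d)}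
    (hu : u ∈ polarCone S) {t : ℝ} (ht : 0 ≤ t) : t • u ∈ polarCone S := fun k hk => by
  rw [inner_smul_right]
  exact mul_nonpos_of_nonneg_of_nonpos ht (hu k hk)

variable (K : ConvexCone ℝ (EuclideanSpace ℝ (Fin d)))

/-- The norm of a Moreau component is dominated by the support function on the unit sphere. -/
lemma sq_norm_le_supInner_sq {S : Set (EuclideanSpace ℝ (Fin d))}
    (hS : ∀ x ∈ S, ∀ t : ℝ, 0 < t → t • x ∈ S) {g p : EuclideanSpace ℝ (Fin d)} (hp : p ∈ S)
    (h : inner ℝ g p = ‖p‖ ^ 2) : ‖p‖ ^ 2 ≤ supInner (S ∩ Metric.sphere 0 1) g ^ 2 := by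
  by_cases h0 : p = 0
  · rw [h0, norm_zero, zero_pow two_ne_zero]
    positivity
  · have hn : 0 < ‖p‖ := norm_pos_iff.2 h0
    have h1 := inner_le_supInner (cone_inter_sphere_subset S)
      ⟨hS p hp _ (inv_pos.2 hn), inv_norm_smul_mem_sphere h0⟩ g
    rw [inner_smul_right, h, sq, inv_mul_cancel_left₀ hn.ne'] at h1
    exact pow_le_pow_left₀ hn.le h1 2

lemma supInner_cone_le_norm {S : Set (EuclideanSpace ℝ (Fin d))}
    {g p : EuclideanSpace ℝ (Fin d)} (h : ∀ x ∈ S, inner ℝ (g - p) x ≤ 0) :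
    supInner (S ∩ Metric.sphere 0 1) g ≤ ‖p‖ := by
  rcases (S ∩ Metric.sphere 0 1).eq_empty_or_nonempty with he | hne
  · rw [he, supInner_empty]
    exact norm_nonneg _
  · refine supInner_le hne fun x hx => ?_
    have h1 := h x hx.1
    rw [inner_sub_left] at h1
    linarith [(le_abs_self _).trans (abs_inner_le_norm_of_sphere hx.2 p)]

/-- The dimension is at most the sum of the squared widths of a cone and its polar, plus two. -/
lemma dim_le_width_sq_add (h0 : (0 : EuclideanSpace ℝ (Fin d)) ∈ K)
    (hK : IsClosed (K : Set (EuclideanSpace ℝ (Fin d)))) :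
    (d : ℝ) ≤ sphericalWidth (K : Set (EuclideanSpace ℝ (Fin d))) ^ 2
      + sphericalWidth (polarCone (K : Set (EuclideanSpace ℝ (Fin d)))) ^ 2 + 2 := by
  have s1 := cone_inter_sphere_subset (K : Set (EuclideanSpace ℝ (Fin d)))
  have s2 := cone_inter_sphere_subset (polarCone (K : Set (EuclideanSpace ℝ (Fin d))))
  have v1 := integral_supInner_sq_le s1
  have v2 := integral_supInner_sq_le s2
  have hp : ∀ g, ‖g‖ ^ 2 ≤ supInner ((K : Set (EuclideanSpace ℝ (Fin d))) ∩ Metric.sphere 0 1) g ^ 2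
      + supInner (polarCone (K : Set (EuclideanSpace ℝ (Fin d))) ∩ Metric.sphere 0 1) g ^ 2 := by
    intro g
    obtain ⟨p, hp, hq, ho⟩ := exists_moreau K h0 hK g
    have e : g = p + (g - p) := by abel
    have e1 : inner ℝ g p = ‖p‖ ^ 2 := by
      rw [inner_sub_left, real_inner_self_eq_norm_sq] at ho
      linarith
    have e2 : inner ℝ g (g - p) = ‖g - p‖ ^ 2 := by
      rw [← real_inner_self_eq_norm_sq (g - p)]
      conv_rhs => rw [inner_sub_left, real_inner_comm (g - p) p, ho]
      ring
    have e3 : ‖g‖ ^ 2 = ‖p‖ ^ 2 + ‖g - p‖ ^ 2 := by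
      rw [← e1, ← e2, ← inner_add_right, add_sub_cancel, real_inner_self_eq_norm_sq]
    rw [e3]
    exact add_le_add (sq_norm_le_supInner_sq (fun x hx t ht => K.smul_mem ht hx) hp e1)
      (sq_norm_le_supInner_sq (fun x hx t ht => polarCone_smul hx ht.le) hq e2)
  have hi := integral_mono integrable_norm_sq_stdGaussian
    ((integrable_supInner_sq s1).add (integrable_supInner_sq s2)) hp
  simp only [Pi.add_apply] at hi
  rw [integral_add (integrable_supInner_sq s1) (integrable_supInner_sq s2),
    integral_norm_sq_stdGaussian] at hi
  simp only [sphericalWidth]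
  linarith

/-- Linearization of a square: `r² ≥ (F₊)² ≥ 2 ω F - ω²`. -/
lemma two_mul_sub_sq_le {w F r : ℝ} (hw : 0 ≤ w) (hF : F ≤ r) : 2 * w * F - w ^ 2 ≤ r ^ 2 := by
  nlinarith [sq_nonneg (r - w), mul_le_mul_of_nonneg_left hF hw]

/-- The squared widths of a cone and its polar sum to at most the dimension. -/
lemma width_sq_add_le_dim (h0 : (0 : EuclideanSpace ℝ (Fin d)) ∈ K)
    (hK : IsClosed (K : Set (EuclideanSpace ℝ (Fin d)))) :
    sphericalWidth (K : Set (EuclideanSpace ℝ (Fin d))) ^ 2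
      + sphericalWidth (polarCone (K : Set (EuclideanSpace ℝ (Fin d)))) ^ 2 ≤ d := by
  have s1 := cone_inter_sphere_subset (K : Set (EuclideanSpace ℝ (Fin d)))
  have s2 := cone_inter_sphere_subset (polarCone (K : Set (EuclideanSpace ℝ (Fin d))))
  simp only [sphericalWidth]
  set w1 := gaussianWidth ((K : Set (EuclideanSpace ℝ (Fin d))) ∩ Metric.sphere 0 1) with hw1
  set w2 := gaussianWidth (polarCone (K : Set (EuclideanSpace ℝ (Fin d))) ∩ Metric.sphere 0 1)
    with hw2
  have n1 : 0 ≤ w1 := gaussianWidth_nonneg s1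
  have n2 : 0 ≤ w2 := gaussianWidth_nonneg s2
  have hp : ∀ g, (2 * w1 * supInner ((K : Set (EuclideanSpace ℝ (Fin d))) ∩ Metric.sphere 0 1) g
      - w1 ^ 2) + (2 * w2 *
        supInner (polarCone (K : Set (EuclideanSpace ℝ (Fin d))) ∩ Metric.sphere 0 1) g - w2 ^ 2)
      ≤ ‖g‖ ^ 2 := by
    intro g
    obtain ⟨p, hp, hq, ho⟩ := exists_moreau K h0 hK g
    have e3 : ‖g‖ ^ 2 = ‖p‖ ^ 2 + ‖g - p‖ ^ 2 := by
      have h := norm_add_sq_real (g - p) p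
      rw [sub_add_cancel, ho] at h
      linarith
    rw [e3]
    refine add_le_add (two_mul_sub_sq_le n1 (supInner_cone_le_norm fun x hx => ?_))
      (two_mul_sub_sq_le n2 (supInner_cone_le_norm fun x hx => ?_))
    · rw [real_inner_comm]
      exact hq x hx
    · rw [sub_sub_cancel]
      exact hx p hp
  have i1 : Integrable (fun g => 2 * w1 *
      supInner ((K : Set (EuclideanSpace ℝ (Fin d))) ∩ Metric.sphere 0 1) g - w1 ^ 2)
      (stdGaussian (EuclideanSpace ℝ (Fin d))) :=
    ((integrable_supInner s1).const_mul _).sub (integrable_const _)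
  have i2 : Integrable (fun g => 2 * w2 *
      supInner (polarCone (K : Set (EuclideanSpace ℝ (Fin d))) ∩ Metric.sphere 0 1) g - w2 ^ 2)
      (stdGaussian (EuclideanSpace ℝ (Fin d))) :=
    ((integrable_supInner s2).const_mul _).sub (integrable_const _)
  have hi := integral_mono (i1.add i2) integrable_norm_sq_stdGaussian hp
  simp only [Pi.add_apply] at hi
  rw [integral_add i1 i2, integral_sub ((integrable_supInner s1).const_mul _) (integrable_const _),
    integral_sub ((integrable_supInner s2).const_mul _) (integrable_const _),
    integral_const_mul, integral_const_mul, ← gaussianWidth_eq, ← gaussianWidth_eq, ← hw1, ← hw2,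
    integral_norm_sq_stdGaussian] at hi
  simp only [integral_const, probReal_univ, smul_eq_mul, one_mul] at hi
  linarith

/-- The squared width of a subspace is at most its dimension. -/
lemma width_sq_le_finrank (V : Submodule ℝ (EuclideanSpace ℝ (Fin d))) :
    sphericalWidth (V : Set (EuclideanSpace ℝ (Fin d))) ^ 2 ≤ Module.finrank ℝ V := by
  have s1 := cone_inter_sphere_subset (V : Set (EuclideanSpace ℝ (Fin d)))
  simp only [sphericalWidth]
  set w := gaussianWidth ((V : Set (EuclideanSpace ℝ (Fin d))) ∩ Metric.sphere 0 1) with hw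
  have n1 : 0 ≤ w := gaussianWidth_nonneg s1
  set b := stdOrthonormalBasis ℝ V
  have hp : ∀ g, 2 * w * supInner ((V : Set (EuclideanSpace ℝ (Fin d))) ∩ Metric.sphere 0 1) g
      - w ^ 2 ≤ ∑ i, inner ℝ g (b i : EuclideanSpace ℝ (Fin d)) ^ 2 := by
    intro g
    have e : ∑ i, inner ℝ g (b i : EuclideanSpace ℝ (Fin d)) ^ 2
        = ‖(V.orthogonalProjectionOnto g : EuclideanSpace ℝ (Fin d))‖ ^ 2 := by
      rw [Submodule.norm_coe, ← b.sum_sq_inner_right]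
      refine Finset.sum_congr rfl fun i _ => ?_
      rw [real_inner_comm, V.inner_orthogonalProjectionOnto_eq_of_mem_left]
    rw [e]
    refine two_mul_sub_sq_le n1 (supInner_cone_le_norm fun x hx => ?_)
    exact (V.starProjection_inner_eq_zero g x hx).le
  have hi := integral_mono (((integrable_supInner s1).const_mul (2 * w)).sub
    (integrable_const (w ^ 2))) (integrable_finsetSum _ fun i _ => integrable_inner_sq _) hp
  simp only [Pi.sub_apply] at hi
  rw [integral_sub ((integrable_supInner s1).const_mul _) (integrable_const _),
    integral_const_mul, ← gaussianWidth_eq, ← hw,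
    integral_finsetSum _ fun i _ => integrable_inner_sq _] at hi
  have hb : ∀ i, ‖(b i : EuclideanSpace ℝ (Fin d))‖ = 1 := fun i => by
    rw [Submodule.norm_coe, b.norm_eq_one]
  simp only [integral_inner_sq_stdGaussian, hb, integral_const, probReal_univ, smul_eq_mul,
    one_mul, one_pow, Finset.sum_const, Finset.card_univ, Fintype.card_fin, nsmul_eq_mul,
    mul_one] at hi
  linarith

end ConeWidth

/-! ### Nontrivial solutions of `L c + k = 0` with `c` and `k` in given cones -/

section Kernel

variable {E F : Type*} [NormedAddCommGroup E] [InnerProductSpace ℝ E]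
  [NormedAddCommGroup F] [InnerProductSpace ℝ F] [FiniteDimensional ℝ F]

/-- If `L C + K` lies in no half-space, it is everything. So it contains `-L c` or `-k`, where `c`
or `k` is an element whose negative is missing from its cone, and this yields a relation that is not
trivial. -/
lemma exists_relation_of_not_neg (L : E →ₗ[ℝ] F) (C : ConvexCone ℝ E) (K : ConvexCone ℝ F)
    (hC0 : (0 : E) ∈ C) (hK0 : (0 : F) ∈ K)
    (hpol : ∀ u ∈ polarCone (K : Set F), (∀ c ∈ C, inner ℝ (L c) u ≤ 0) → u = 0)
    (hneg : (∃ c ∈ C, -c ∉ C) ∨ ∃ k ∈ K, -k ∉ K) :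
    ∃ c ∈ C, ∃ k ∈ K, (c ≠ 0 ∨ k ≠ 0) ∧ L c + k = 0 := by
  set D : ConvexCone ℝ F := C.map L + K with hD
  have memD : ∀ y, y ∈ D ↔ ∃ c ∈ C, ∃ k ∈ K, L c + k = y := by
    intro y
    rw [hD, ConvexCone.mem_add]
    constructor
    · rintro ⟨_, hx, k, hk, rfl⟩
      obtain ⟨c, hc, rfl⟩ := hx
      exact ⟨c, hc, k, hk, rfl⟩
    · rintro ⟨c, hc, k, hk, rfl⟩
      exact ⟨L c, ⟨c, hc, rfl⟩, k, hk, rfl⟩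
  have hD0 : (0 : F) ∈ D := (memD 0).2 ⟨0, hC0, 0, hK0, by simp⟩
  have huniv : (D : Set F) = Set.univ := by
    refine eq_univ_of_polarCone D hD0 fun u hu => hpol u (fun k hk => ?_) fun c hc => ?_
    · exact hu k ((memD k).2 ⟨0, hC0, k, hk, by simp⟩)
    · exact hu (L c) ((memD _).2 ⟨c, hc, 0, hK0, by simp⟩)
  have all : ∀ y, ∃ c ∈ C, ∃ k ∈ K, L c + k = y := fun y =>
    (memD y).1 (by rw [← SetLike.mem_coe, huniv]; trivial)
  rcases hneg with ⟨c, hc, hcn⟩ | ⟨k, hk, hkn⟩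
  · obtain ⟨c', hc', k', hk', e⟩ := all (-L c)
    refine ⟨c + c', C.add_mem hc hc', k', hk', Or.inl fun h => hcn ?_, ?_⟩
    · rwa [← eq_neg_of_add_eq_zero_right h]
    · rw [map_add, add_assoc, e, add_neg_cancel]
  · obtain ⟨c', hc', k', hk', e⟩ := all (-k)
    refine ⟨c', hc', k + k', K.add_mem hk hk', Or.inr fun h => hkn ?_, ?_⟩
    · rwa [← eq_neg_of_add_eq_zero_right h]
    · rw [add_left_comm, e, add_neg_cancel]

/-- Two subspaces whose dimensions exceed that of the ambient space have a nontrivial relation. -/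
lemma exists_relation_of_finrank_lt [FiniteDimensional ℝ E] (L : E →ₗ[ℝ] F)
    (V : Submodule ℝ E) (W : Submodule ℝ F)
    (h : Module.finrank ℝ F < Module.finrank ℝ V + Module.finrank ℝ W) :
    ∃ c ∈ V, ∃ k ∈ W, (c ≠ 0 ∨ k ≠ 0) ∧ L c + k = 0 := by
  have hk := LinearMap.ker_ne_bot_of_finrank_lt
    (f := (L.comp V.subtype).coprod W.subtype) (by rwa [Module.finrank_prod])
  obtain ⟨⟨c, k⟩, hmem, hne⟩ := (Submodule.ne_bot_iff _).1 hk
  refine ⟨c, c.2, k, k.2, ?_, by simpa using hmem⟩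
  by_contra! hcon
  exact hne (Prod.ext (Subtype.ext hcon.1) (Subtype.ext hcon.2))

/-- A convex cone that contains `0` and is symmetric is a subspace. -/
def ConvexCone.toSubmoduleOfNeg (C : ConvexCone ℝ E) (h0 : (0 : E) ∈ C)
    (hneg : ∀ c ∈ C, -c ∈ C) : Submodule ℝ E where
  carrier := C
  zero_mem' := h0
  add_mem' := fun ha hb => C.add_mem ha hb
  smul_mem' := fun t x hx => by
    rcases lt_trichotomy t 0 with h | h | h
    · have := C.smul_mem (neg_pos.2 h) (hneg x hx)
      simpa using this
    · subst h
      simpa using h0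
    · exact C.smul_mem h hx

end Kernel

/-! ### Tangent cones of convex functions and the two programs -/

section Tangent

variable {E : Type*} [AddCommGroup E] [Module ℝ E] {f : E → EReal}

/-- If `f x = ⊤` the sublevel set is everything. -/
lemma IsProperConvex.convex_sublevel (hf : IsProperConvex f) (x : E) :
    Convex ℝ {y | f y ≤ f x} := by
  by_cases htop : f x = ⊤
  · simp [htop, convex_univ]
  · have hr : ((f x).toReal : EReal) = f x := EReal.coe_toReal htop (hf.ne_bot x)
    intro y hy z hz a b ha hb hab
    change f y ≤ f x at hy
    change f z ≤ f x at hz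
    change f (a • y + b • z) ≤ f x
    rw [← hr] at hy hz ⊢
    have h := hf.convex_epigraph (x := (y, (f x).toReal)) hy (y := (z, (f x).toReal)) hz ha hb hab
    have e : a • (f x).toReal + b • (f x).toReal = (f x).toReal := by
      rw [← add_smul, hab, one_smul]
    change f (a • y + b • z) ≤ ((a • (f x).toReal + b • (f x).toReal : ℝ) : EReal) at h
    rwa [e] at h

/-- Descent along `u` persists for shorter steps. -/
lemma IsProperConvex.descent_of_le (hf : IsProperConvex f) {x u : E} {s t : ℝ} (hs : 0 ≤ s)
    (hst : s ≤ t) (ht : 0 < t) (h : f (x + t • u) ≤ f x) : f (x + s • u) ≤ f x := by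
  have hx : x ∈ {y | f y ≤ f x} := le_rfl (a := f x)
  have hxt : x + t • u ∈ {y | f y ≤ f x} := h
  have h1 := hf.convex_sublevel x hx hxt (a := 1 - s / t) (b := s / t)
    (sub_nonneg.2 ((div_le_one ht).2 hst)) (div_nonneg hs ht.le) (by ring)
  have e : (1 - s / t) • x + (s / t) • (x + t • u) = x + s • u := by
    rw [smul_add, smul_smul, div_mul_cancel₀ _ ht.ne']
    module
  rwa [e] at h1

lemma zero_mem_tangentCone (x : E) : (0 : E) ∈ tangentCone f x := ⟨1, one_pos, by simp⟩

/-- The tangent cone of a convex function as a convex cone. -/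
def tangentConvexCone (hf : IsProperConvex f) (x : E) : ConvexCone ℝ E where
  carrier := tangentCone f x
  smul_mem' := by
    rintro c hc u ⟨t, ht, h⟩
    refine ⟨t / c, div_pos ht hc, ?_⟩
    rwa [smul_smul, div_mul_cancel₀ _ hc.ne']
  add_mem' := by
    rintro u ⟨s, hs, hu⟩ v ⟨t, ht, hv⟩
    have hr : 0 < min s t := lt_min hs ht
    have h1 : x + min s t • u ∈ {y | f y ≤ f x} := hf.descent_of_le hr.le (min_le_left s t) hs hu
    have h2 : x + min s t • v ∈ {y | f y ≤ f x} := hf.descent_of_le hr.le (min_le_right s t) ht hv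
    refine ⟨min s t / 2, by positivity, ?_⟩
    have h3 := hf.convex_sublevel x h1 h2 (a := 1 / 2) (b := 1 / 2) (by norm_num) (by norm_num)
      (by norm_num)
    have e : (1 / 2 : ℝ) • (x + min s t • u) + (1 / 2 : ℝ) • (x + min s t • v)
        = x + (min s t / 2) • (u + v) := by module
    rwa [e] at h3

end Tangent

section Programs

variable {n m : ℕ} {f : EuclideanSpace ℝ (Fin n) → EReal} {g : EuclideanSpace ℝ (Fin m) → EReal}
  {xs : EuclideanSpace ℝ (Fin n)} {vs : EuclideanSpace ℝ (Fin m)}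
  {Φ : Matrix (Fin m) (Fin n) ℝ}

/-- A point is the unique minimizer as soon as every feasible point that is at least as good
coincides with it, and conversely. -/
lemma solutionSet_eq_singleton_iff {α : Type*} {F : Set α} {obj : α → EReal} {p : α}
    (hp : p ∈ F) : solutionSet F obj = {p} ↔ ∀ q ∈ F, obj q ≤ obj p → q = p := by
  constructor
  · intro h q hq hqp
    have hpS : p ∈ solutionSet F obj := h ▸ Set.mem_singleton p
    have : q ∈ solutionSet F obj := ⟨hq, fun r hr => hqp.trans (hpS.2 r hr)⟩
    rwa [h] at this
  · intro h
    ext q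
    constructor
    · exact fun hq => h q hq.1 (hq.2 p hp)
    · rintro rfl
      refine ⟨hp, fun r hr => ?_⟩
      by_contra hlt
      have := h r hr (not_le.1 hlt).le
      exact hlt (this ▸ le_rfl)

lemma succeeds₁_iff : Succeeds₁ f g xs vs Φ ↔ ∀ x v,
    measurement Φ xs vs = measurement Φ x v → f x ≤ f xs → g v ≤ g vs → (x, v) = (xs, vs) := by
  have hp : (xs, vs) ∈ {p : EuclideanSpace ℝ (Fin n) × EuclideanSpace ℝ (Fin m) |
      measurement Φ xs vs = measurement Φ p.1 p.2 ∧ g p.2 ≤ g vs} := ⟨rfl, le_rfl⟩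
  rw [Succeeds₁, solutionSet_eq_singleton_iff hp]
  exact ⟨fun h x v e hf hg => h (x, v) ⟨e, hg⟩ hf, fun h q hq hf => h q.1 q.2 hq.1 hf hq.2⟩

lemma succeeds₂_iff : Succeeds₂ f g xs vs Φ ↔ ∀ x v,
    measurement Φ xs vs = measurement Φ x v → f x ≤ f xs → g v ≤ g vs → (x, v) = (xs, vs) := by
  have hp : (xs, vs) ∈ {p : EuclideanSpace ℝ (Fin n) × EuclideanSpace ℝ (Fin m) |
      measurement Φ xs vs = measurement Φ p.1 p.2 ∧ f p.1 ≤ f xs} := ⟨rfl, le_rfl⟩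
  rw [Succeeds₂, solutionSet_eq_singleton_iff hp]
  exact ⟨fun h x v e hf hg => h (x, v) ⟨e, hf⟩ hg, fun h q hq hf => h q.1 q.2 hq.1 hq.2 hf⟩

/-- The event of failure, common to both programs: the cones have a nontrivial relation. -/
def HasRelation (f : EuclideanSpace ℝ (Fin n) → EReal) (g : EuclideanSpace ℝ (Fin m) → EReal)
    (xs : EuclideanSpace ℝ (Fin n)) (vs : EuclideanSpace ℝ (Fin m))
    (Φ : Matrix (Fin m) (Fin n) ℝ) : Prop :=
  ∃ c ∈ tangentCone f xs, ∃ k ∈ tangentCone g vs, (c ≠ 0 ∨ k ≠ 0) ∧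
    Matrix.toEuclideanLin Φ c + k = 0

lemma exists_better_iff_hasRelation (hf : IsProperConvex f) (hg : IsProperConvex g) :
    (∃ x v, measurement Φ xs vs = measurement Φ x v ∧ f x ≤ f xs ∧ g v ≤ g vs ∧
      (x, v) ≠ (xs, vs)) ↔ HasRelation f g xs vs Φ := by
  have hm0 : ∀ w : EuclideanSpace ℝ (Fin m), w ≠ 0 → 0 < Real.sqrt m := by
    intro w hw
    refine Real.sqrt_pos.2 (Nat.cast_pos.2 (Nat.pos_of_ne_zero ?_))
    rintro rfl
    exact hw (Subsingleton.elim _ _)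
  constructor
  · rintro ⟨x, v, e, hx, hv, hne⟩
    refine ⟨x - xs, ⟨1, one_pos, by simpa using hx⟩, Real.sqrt m • (v - vs), ?_, ?_, ?_⟩
    · have hv' : v - vs ∈ tangentCone g vs := ⟨1, one_pos, by simpa using hv⟩
      by_cases h0 : v - vs = 0
      · rw [h0, smul_zero]
        exact zero_mem_tangentCone vs
      · exact (tangentConvexCone hg vs).smul_mem (hm0 _ h0) hv'
    · by_contra! hcon
      refine hne (Prod.ext (sub_eq_zero.1 hcon.1) ?_)
      by_contra hvne
      exact (smul_ne_zero (hm0 _ (sub_ne_zero.2 hvne)).ne' (sub_ne_zero.2 hvne)) hcon.2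
    · rw [measurement, measurement] at e
      rw [map_sub, smul_sub, sub_add_sub_comm, e, sub_self]
  · rintro ⟨c, ⟨s, hs, hc⟩, k, hk, hne, e⟩
    -- The second coordinate moves by `k / √m`; for `m = 0` both vanish.
    obtain ⟨b, hb, hbk⟩ : ∃ b ∈ tangentCone g vs, Real.sqrt m • b = k := by
      by_cases h0 : k = 0
      · exact ⟨0, zero_mem_tangentCone vs, by rw [h0, smul_zero]⟩
      · have := hm0 k h0
        exact ⟨(Real.sqrt m)⁻¹ • k, (tangentConvexCone hg vs).smul_mem (inv_pos.2 this) hk,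
          smul_inv_smul₀ this.ne' k⟩
    obtain ⟨t, ht, hbt⟩ := hb
    have hr : 0 < min s t := lt_min hs ht
    refine ⟨xs + min s t • c, vs + min s t • b, ?_,
      hf.descent_of_le hr.le (min_le_left s t) hs hc,
      hg.descent_of_le hr.le (min_le_right s t) ht hbt, fun h => ?_⟩
    · rw [measurement, measurement, map_add, map_smul, smul_add, smul_comm (Real.sqrt m), hbk,
        add_add_add_comm, ← smul_add, e, smul_zero, add_zero]
    · rw [Prod.mk.injEq, add_eq_left, add_eq_left, smul_eq_zero, smul_eq_zero] at h
      have hc0 : c = 0 := h.1.resolve_left hr.ne'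
      have hb0 : b = 0 := h.2.resolve_left hr.ne'
      rcases hne with h1 | h1
      · exact h1 hc0
      · exact h1 (by rw [← hbk, hb0, smul_zero])

lemma succeeds₁_iff_not_hasRelation (hf : IsProperConvex f) (hg : IsProperConvex g) :
    Succeeds₁ f g xs vs Φ ↔ ¬HasRelation f g xs vs Φ := by
  rw [← exists_better_iff_hasRelation hf hg, succeeds₁_iff]
  push Not
  rfl

lemma succeeds₂_iff_not_hasRelation (hf : IsProperConvex f) (hg : IsProperConvex g) :
    Succeeds₂ f g xs vs Φ ↔ ¬HasRelation f g xs vs Φ := by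
  rw [succeeds₂_iff, ← succeeds₁_iff, succeeds₁_iff_not_hasRelation hf hg]

end Programs

/-! ### The random matrix -/

section RandomMatrix

variable {n m : ℕ} {Ω : Type*} [MeasurableSpace Ω] {P : Measure Ω}
  {Φ : Ω → Matrix (Fin m) (Fin n) ℝ}

lemma inner_toEuclideanLin (M : Matrix (Fin m) (Fin n) ℝ) (a : EuclideanSpace ℝ (Fin n))
    (u : EuclideanSpace ℝ (Fin m)) :
    inner ℝ (Matrix.toEuclideanLin M a) u = ∑ s : Fin m × Fin n, M s.1 s.2 *
      (u.ofLp s.1 * a.ofLp s.2) := by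
  rw [Fintype.sum_prod_type]
  simp only [PiLp.inner_apply, Matrix.toLpLin_apply, Matrix.mulVec, dotProduct]
  refine Finset.sum_congr rfl fun i _ => ?_
  simp only [RCLike.inner_apply, conj_trivial, Finset.mul_sum]
  exact Finset.sum_congr rfl fun j _ => by ring

lemma measureReal_preimage_le_of_hasLaw {Y : Type*} [MeasurableSpace Y] {ν : Measure Y}
    [IsFiniteMeasure ν] {X : Ω → Y} (hX : HasLaw X ν P) (B : Set Y) :
    P.real {ω | X ω ∈ B} ≤ ν.real B := by
  refine ENNReal.toReal_mono (measure_ne_top _ _) ?_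
  have h := Measure.le_map_apply hX.aemeasurable B
  rwa [hX.map_eq] at h

variable [IsProbabilityMeasure P]

lemma IsGaussianMatrix.hasLaw (hΦ : IsGaussianMatrix Φ P) :
    HasLaw (fun ω (s : Fin m × Fin n) => Φ ω s.1 s.2) (gaussianPi (Fin m × Fin n)) P where
  aemeasurable := aemeasurable_pi_lambda _ fun s => (hΦ.hasLaw_entry s.1 s.2).aemeasurable
  map_eq := by
    have h := (iIndepFun_iff_map_fun_eq_pi_map (f := fun (s : Fin m × Fin n) ω => Φ ω s.1 s.2)
      fun s => (hΦ.hasLaw_entry s.1 s.2).aemeasurable).1 hΦ.indep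
    refine h.trans ?_
    congr 1
    ext1 s
    exact (hΦ.hasLaw_entry s.1 s.2).map_eq

lemma IsGaussianMatrix.exists_polar_le (hΦ : IsGaussianMatrix Φ P)
    {A : Set (EuclideanSpace ℝ (Fin n))} {U : Set (EuclideanSpace ℝ (Fin m))}
    (hA : A ⊆ Metric.sphere 0 1) (hU : U ⊆ Metric.sphere 0 1)
    {ε : ℝ} (hε : 0 < ε) (h : gaussianWidth A + ε ≤ gaussianWidth U) :
    P.real {ω | ∃ a ∈ A, ∀ u ∈ U, inner ℝ (Matrix.toEuclideanLin (Φ ω) a) u ≤ 0}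
      ≤ Real.exp (-ε ^ 2 / 2) := by
  refine le_trans ?_ (gaussianPi_exists_polar_le hA hU hε h)
  refine le_trans (le_of_eq ?_) (measureReal_preimage_le_of_hasLaw hΦ.hasLaw _)
  simp only [inner_toEuclideanLin, Set.mem_ofPred_eq]

/-- The same bound with the roles of the two spaces exchanged, i.e. for the transposed matrix. -/
lemma IsGaussianMatrix.exists_polar_transpose_le (hΦ : IsGaussianMatrix Φ P)
    {A : Set (EuclideanSpace ℝ (Fin m))} {U : Set (EuclideanSpace ℝ (Fin n))}
    (hA : A ⊆ Metric.sphere 0 1) (hU : U ⊆ Metric.sphere 0 1)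
    {ε : ℝ} (hε : 0 < ε) (h : gaussianWidth A + ε ≤ gaussianWidth U) :
    P.real {ω | ∃ a ∈ A, ∀ u ∈ U, inner ℝ (Matrix.toEuclideanLin (Φ ω) u) a ≤ 0}
      ≤ Real.exp (-ε ^ 2 / 2) := by
  have mp := measurePreserving_comp_equiv (Equiv.prodComm (Fin n) (Fin m))
  have law : HasLaw (fun ω (s : Fin n × Fin m) => Φ ω s.2 s.1) (gaussianPi (Fin n × Fin m)) P :=
    ⟨mp.measurable.comp_aemeasurable hΦ.hasLaw.aemeasurable, by
      rw [← mp.map_eq, ← hΦ.hasLaw.map_eq,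
        AEMeasurable.map_map_of_aemeasurable (mp.measurable.aemeasurable) hΦ.hasLaw.aemeasurable]
      rfl⟩
  refine le_trans ?_ (gaussianPi_exists_polar_le hA hU hε h)
  refine le_trans (le_of_eq ?_) (measureReal_preimage_le_of_hasLaw law _)
  have e : ∀ ω (a : EuclideanSpace ℝ (Fin m)) (u : EuclideanSpace ℝ (Fin n)),
      inner ℝ (Matrix.toEuclideanLin (Φ ω) u) a
        = ∑ s : Fin n × Fin m, Φ ω s.2 s.1 * (u.ofLp s.1 * a.ofLp s.2) := by
    intro ω a u
    rw [inner_toEuclideanLin, ← (Equiv.prodComm (Fin n) (Fin m)).sum_comp]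
    refine Finset.sum_congr rfl fun s _ => ?_
    simp only [Equiv.prodComm_apply, Prod.fst_swap, Prod.snd_swap]
    ring
  simp only [e, Set.mem_ofPred_eq]

/-- No measurability of `S` is needed. -/
lemma one_sub_le_measureReal {S B : Set Ω} (h : ∀ ω, ω ∉ B → ω ∈ S) {r : ℝ}
    (hB : P.real B ≤ r) : 1 - r ≤ P.real S := by
  have h1 : P.real (S ∪ B) = 1 := by
    have : S ∪ B = Set.univ := Set.eq_univ_of_forall fun ω => by
      by_cases hω : ω ∈ B
      · exact Or.inr hω
      · exact Or.inl (h ω hω)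
    rw [this, probReal_univ]
  linarith [measureReal_union_le (μ := P) S B]

lemma exp_neg_sq_half_le (ε : ℝ) : Real.exp (-ε ^ 2 / 2) ≤ 2 * Real.exp (-ε ^ 2 / 4) := by
  have h1 : Real.exp (-ε ^ 2 / 2) ≤ Real.exp (-ε ^ 2 / 4) :=
    Real.exp_le_exp.2 (by nlinarith [sq_nonneg ε])
  linarith [Real.exp_pos (-ε ^ 2 / 4)]

variable {f : EuclideanSpace ℝ (Fin n) → EReal} {g : EuclideanSpace ℝ (Fin m) → EReal}
  {xs : EuclideanSpace ℝ (Fin n)} {vs : EuclideanSpace ℝ (Fin m)}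

lemma prob_hasRelation_le (hΦ : IsGaussianMatrix Φ P) (hg : IsProperConvex g)
    (hf : IsProperConvex f) (hTg : IsClosed (tangentCone g vs)) {ε : ℝ} (hε : 0 < ε)
    (hm : Real.sqrt m ≥ Real.sqrt (criticalPoint f g xs vs) + Real.sqrt 2 + ε) :
    P.real {ω | HasRelation f g xs vs (Φ ω)} ≤ Real.exp (-ε ^ 2 / 2) := by
  set C := tangentCone f xs with hC
  set K := tangentCone g vs with hK
  have sC := cone_inter_sphere_subset C
  have sK := cone_inter_sphere_subset (polarCone K)
  have width : sphericalWidth C + ε ≤ sphericalWidth (polarCone K) := by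
    have d1 := dim_le_width_sq_add (tangentConvexCone hg vs) (zero_mem_tangentCone vs) hTg
    change (m : ℝ) ≤ sphericalWidth K ^ 2 + sphericalWidth (polarCone K) ^ 2 + 2 at d1
    have c0 : 0 ≤ criticalPoint f g xs vs := by unfold criticalPoint; positivity
    have s0 := Real.sqrt_nonneg (criticalPoint f g xs vs)
    have s1 := Real.sq_sqrt c0
    have t0 := Real.sqrt_nonneg 2
    have t1 : Real.sqrt 2 ^ 2 = 2 := Real.sq_sqrt (by norm_num)
    have m1 : Real.sqrt m ^ 2 = m := Real.sq_sqrt (by positivity)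
    have wC : 0 ≤ sphericalWidth C := gaussianWidth_nonneg sC
    have wK : 0 ≤ sphericalWidth (polarCone K) := gaussianWidth_nonneg sK
    have e : criticalPoint f g xs vs = sphericalWidth C ^ 2 + sphericalWidth K ^ 2 := rfl
    have le : sphericalWidth C ≤ Real.sqrt (criticalPoint f g xs vs) :=
      Real.le_sqrt_of_sq_le (by rw [e]; linarith [sq_nonneg (sphericalWidth K)])
    have sq := pow_le_pow_left₀ (by positivity) hm 2
    refine le_of_sq_le_sq ?_ wK
    nlinarith [mul_le_mul_of_nonneg_right le hε.le, mul_nonneg s0 t0, mul_nonneg t0 hε.le]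
  have hU : Neg.neg ⁻¹' (polarCone K ∩ Metric.sphere 0 1)
      ⊆ Metric.sphere (0 : EuclideanSpace ℝ (Fin m)) 1 := by
    rintro u ⟨-, hu⟩
    rw [mem_sphere_zero_iff_norm] at hu ⊢
    rwa [norm_neg] at hu
  refine le_trans (measureReal_mono ?_) (hΦ.exists_polar_le sC hU hε
    (by rw [gaussianWidth_neg sK]; exact width))
  rintro ω ⟨c, hc, k, hk, hne, e⟩
  have hck : Matrix.toEuclideanLin (Φ ω) c = -k := eq_neg_of_add_eq_zero_left e
  have hc0 : c ≠ 0 := by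
    rintro rfl
    rw [map_zero, zero_add] at e
    exact hne.elim (fun h => h rfl) (fun h => h e)
  have hn : 0 < ‖c‖ := norm_pos_iff.2 hc0
  refine ⟨‖c‖⁻¹ • c, ⟨(tangentConvexCone hf xs).smul_mem (inv_pos.2 hn) hc,
    inv_norm_smul_mem_sphere hc0⟩, fun u hu => ?_⟩
  rw [map_smul, hck, inner_smul_left, inner_neg_left, ← inner_neg_right]
  exact mul_nonpos_of_nonneg_of_nonpos (by simp) (hu.1 k hk)

lemma prob_not_hasRelation_le (hΦ : IsGaussianMatrix Φ P) (hf : IsProperConvex f)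
    (hg : IsProperConvex g) (hTg : IsClosed (tangentCone g vs)) {ε : ℝ} (hε : 0 < ε)
    (hm : Real.sqrt m ≤ Real.sqrt (criticalPoint f g xs vs) - ε) :
    P.real {ω | ¬HasRelation f g xs vs (Φ ω)} ≤ Real.exp (-ε ^ 2 / 2) := by
  set C := tangentCone f xs with hC
  set K := tangentCone g vs with hK
  have sC := cone_inter_sphere_subset C
  have sK := cone_inter_sphere_subset (polarCone K)
  have c0 : 0 ≤ criticalPoint f g xs vs := by unfold criticalPoint; positivity
  have s0 := Real.sqrt_nonneg (criticalPoint f g xs vs)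
  have s1 := Real.sq_sqrt c0
  have r0 := Real.sqrt_nonneg (m : ℝ)
  have m1 : Real.sqrt m ^ 2 = m := Real.sq_sqrt (by positivity)
  have e : criticalPoint f g xs vs = sphericalWidth C ^ 2 + sphericalWidth K ^ 2 := rfl
  have sq := pow_le_pow_left₀ (by positivity) (le_sub_iff_add_le.1 hm) 2
  rw [s1] at sq
  -- If both cones are subspaces, a dimension count gives a relation for every matrix.
  by_cases hneg : (∃ c ∈ tangentConvexCone hf xs, -c ∉ tangentConvexCone hf xs) ∨
      ∃ k ∈ tangentConvexCone hg vs, -k ∉ tangentConvexCone hg vs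
  · have width : sphericalWidth (polarCone K) + ε ≤ sphericalWidth C := by
      have d1 := width_sq_add_le_dim (tangentConvexCone hg vs) (zero_mem_tangentCone vs) hTg
      change sphericalWidth K ^ 2 + sphericalWidth (polarCone K) ^ 2 ≤ (m : ℝ) at d1
      have wC : 0 ≤ sphericalWidth C := gaussianWidth_nonneg sC
      have wK : 0 ≤ sphericalWidth (polarCone K) := gaussianWidth_nonneg sK
      have le : sphericalWidth (polarCone K) ≤ Real.sqrt m :=
        Real.le_sqrt_of_sq_le (by linarith [sq_nonneg (sphericalWidth K)])
      refine le_of_sq_le_sq ?_ wC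
      nlinarith [mul_le_mul_of_nonneg_right le hε.le]
    refine le_trans (measureReal_mono ?_) (hΦ.exists_polar_transpose_le sK sC hε width)
    intro ω hω
    by_contra hcon
    refine hω (exists_relation_of_not_neg (Matrix.toEuclideanLin (Φ ω)) (tangentConvexCone hf xs)
      (tangentConvexCone hg vs) (zero_mem_tangentCone xs) (zero_mem_tangentCone vs)
      (fun u hu hcu => ?_) hneg)
    by_contra hu0
    refine hcon ⟨‖u‖⁻¹ • u, ⟨polarCone_smul hu (by positivity), inv_norm_smul_mem_sphere hu0⟩,
      fun c hc => ?_⟩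
    rw [inner_smul_right]
    exact mul_nonpos_of_nonneg_of_nonpos (by positivity) (hcu c hc.1)
  · push Not at hneg
    set V := ConvexCone.toSubmoduleOfNeg (tangentConvexCone hf xs) (zero_mem_tangentCone xs) hneg.1
    set W := ConvexCone.toSubmoduleOfNeg (tangentConvexCone hg vs) (zero_mem_tangentCone vs) hneg.2
    have wV : sphericalWidth C ^ 2 ≤ Module.finrank ℝ V := width_sq_le_finrank V
    have wW : sphericalWidth K ^ 2 ≤ Module.finrank ℝ W := width_sq_le_finrank W
    have hlt : Module.finrank ℝ (EuclideanSpace ℝ (Fin m))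
        < Module.finrank ℝ V + Module.finrank ℝ W := by
      rw [finrank_euclideanSpace_fin]
      have : (m : ℝ) < Module.finrank ℝ V + Module.finrank ℝ W := by
        nlinarith [mul_nonneg r0 hε.le, mul_pos hε hε]
      exact_mod_cast this
    have : {ω | ¬HasRelation f g xs vs (Φ ω)} = ∅ := by
      refine Set.eq_empty_of_forall_notMem fun ω hω => hω ?_
      exact exists_relation_of_finrank_lt (Matrix.toEuclideanLin (Φ ω)) V W hlt
    rw [this, measureReal_empty]
    positivity

end RandomMatrix

end CorruptedSensing

theorem theorem1 {n m : ℕ} {Ω : Type*} [MeasurableSpace Ω] (P : Measure Ω)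
    [IsProbabilityMeasure P] (Φ : Ω → Matrix (Fin m) (Fin n) ℝ)
    (hΦ : CorruptedSensing.IsGaussianMatrix Φ P)
    (f : EuclideanSpace ℝ (Fin n) → EReal) (g : EuclideanSpace ℝ (Fin m) → EReal)
    (hf : CorruptedSensing.IsProperConvex f) (hg : CorruptedSensing.IsProperConvex g)
    (xs : EuclideanSpace ℝ (Fin n)) (vs : EuclideanSpace ℝ (Fin m))
    (hTf : (CorruptedSensing.tangentCone f xs).Nonempty)
    (hTf' : IsClosed (CorruptedSensing.tangentCone f xs))
    (hTg : (CorruptedSensing.tangentCone g vs).Nonempty)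
    (hTg' : IsClosed (CorruptedSensing.tangentCone g vs))
    (ε : ℝ) (hε : 0 ≤ ε) :
    (Real.sqrt m ≥ Real.sqrt (CorruptedSensing.criticalPoint f g xs vs) + Real.sqrt 2 + ε →
      P.real {ω | CorruptedSensing.Succeeds₁ f g xs vs (Φ ω) ∧
          CorruptedSensing.Succeeds₂ f g xs vs (Φ ω)}
        ≥ 1 - 2 * Real.exp (-ε ^ 2 / 4)) ∧
    (Real.sqrt m ≤ Real.sqrt (CorruptedSensing.criticalPoint f g xs vs) - ε →
      P.real {ω | ¬ CorruptedSensing.Succeeds₁ f g xs vs (Φ ω) ∧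
          ¬ CorruptedSensing.Succeeds₂ f g xs vs (Φ ω)}
        ≥ 1 - 2 * Real.exp (-ε ^ 2 / 4)) := by
  have S1 : ∀ {M : Matrix (Fin m) (Fin n) ℝ}, CorruptedSensing.Succeeds₁ f g xs vs M ↔
      ¬CorruptedSensing.HasRelation f g xs vs M :=
    CorruptedSensing.succeeds₁_iff_not_hasRelation hf hg
  have S2 : ∀ {M : Matrix (Fin m) (Fin n) ℝ}, CorruptedSensing.Succeeds₂ f g xs vs M ↔
      ¬CorruptedSensing.HasRelation f g xs vs M :=
    CorruptedSensing.succeeds₂_iff_not_hasRelation hf hg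
  rcases hε.eq_or_lt with rfl | hε
  · -- For `ε = 0` the claimed lower bound is `-1`.
    have h : ∀ S : Set Ω, P.real S ≥ 1 - 2 * Real.exp (-(0 : ℝ) ^ 2 / 4) := fun S => by
      have := measureReal_nonneg (μ := P) (s := S)
      norm_num
      linarith
    exact ⟨fun _ => h _, fun _ => h _⟩
  · refine ⟨fun hm => ?_, fun hm => ?_⟩
    · refine CorruptedSensing.one_sub_le_measureReal
        (B := {ω | CorruptedSensing.HasRelation f g xs vs (Φ ω)})
        ?_ ((CorruptedSensing.prob_hasRelation_le hΦ hg hf hTg' hε hm).trans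
          (CorruptedSensing.exp_neg_sq_half_le ε))
      exact fun ω hω => ⟨S1.2 hω, S2.2 hω⟩
    · refine CorruptedSensing.one_sub_le_measureReal
        (B := {ω | ¬CorruptedSensing.HasRelation f g xs vs (Φ ω)})
        ?_ ((CorruptedSensing.prob_not_hasRelation_le hΦ hf hg hTg' hε hm).trans
          (CorruptedSensing.exp_neg_sq_half_le ε))
      exact fun ω hω => ⟨fun h => hω (S1.1 h), fun h => hω (S2.1 h)⟩
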